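/- Let $(M,g,\nabla,\nabla^*)$ be a dually flat manifold: $M$ is a smooth (Hausdorff, boundaryless) $n$-dimensional manifold, $g$ a smooth Riemannian metric on $M$, and $\nabla,\nabla^*$ smooth affine connections that are dual with respect to $g$, i.e. $X\,g(Y,Z)=g(\nabla_XY,Z)+g(Y,\nabla^*_XZ)$ for all vector fields $X,Y,Z$, and that are both torsion-free and flat (of zero curvature). Then $M$ carries a pair of Monge–Ampère manifold structures, one in $\nabla$-affine coordinates $\eta$ and one in dual $\nabla^*$-affine coordinates $\eta^*$. Precisely: every point of $M$ has an open neighbourhood $U$ with smooth coordinate systems $\eta=(\eta^i)$ and $\eta^*=(\eta^*_i)$ on $U$, with coordinate fields $\partial_i=\partial/\partial\eta^i$ and $\partial^i=\partial/\partial\eta^*_i$, and smooth functions $\psi$ on $\eta(U)$ and $\psi^*$ on $\eta^*(U)$ such that 1. $\eta$ is $\nabla$-affine ($\nabla_{\partial_i}\partial_j=0$), $\eta^*$ is $\nabla^*$-affine ($\nabla^*_{\partial^i}\partial^j=0$), and they are mutually dual: $g(\partial_i,\partial^j)=\delta_i^j$; 2. $g(\partial_i,\partial_j)=g_{ij}=\partial_i\partial_j\psi(\eta)$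 and $g(\partial^i,\partial^j)=g^{ij}=\partial^i\partial^j\psi^*(\eta^*)$, where $(g^{ij})$ is the inverse matrix of $(g_{ij})$; 3. the coordinates are exchanged by the Legendre transformation: $\eta^*_i=\partial_i\psi(\eta)$, $\eta^i=\partial^i\psi^*(\eta^*)$ and $\psi(\eta)+\psi^*(\eta^*)=\sum_i\eta^i\eta^*_i$; 4. $\psi$ and $\psi^*$ solve elliptic Monge–Ampère equations: $\det\mathrm{Hess}(\psi)=f$ on $\eta(U)$ and $\det\mathrm{Hess}(\psi^*)=f^*$ on $\eta^*(U)$, with $f,f^*$ smooth and positive (in particular nowhere zero), and $\mathrm{Hess}(\psi)$, $\mathrm{Hess}(\psi^*)$ positive definite. -/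

import Mathlib

open scoped Manifold ContDiff Bundle

noncomputable section

/-! ### Dually flat manifolds -/

section DuallyFlat

variable {n : ℕ} {M : Type*} [TopologicalSpace M] [ChartedSpace (EuclideanSpace ℝ (Fin n)) M]
  [IsManifold (𝓡 n) ∞ M]

/-- An affine connection on `M`: a covariant derivative on the tangent bundle.
Argument order: `D Y x (X x)` is `(∇_X Y)(x)`. -/
abbrev AffineConnection (n : ℕ) (M : Type*) [TopologicalSpace M]
    [ChartedSpace (EuclideanSpace ℝ (Fin n)) M] [IsManifold (𝓡 n) ∞ M] :=
  CovariantDerivative (𝓡 n) (EuclideanSpace ℝ (Fin n)) (TangentSpace (𝓡 n) : M → Type _)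

/-- A smooth Riemannian metric on `M`. -/
abbrev SmoothMetric (n : ℕ) (M : Type*) [TopologicalSpace M]
    [ChartedSpace (EuclideanSpace ℝ (Fin n)) M] [IsManifold (𝓡 n) ∞ M] :=
  Bundle.ContMDiffRiemannianMetric (𝓡 n) ∞ (EuclideanSpace ℝ (Fin n))
    (TangentSpace (𝓡 n) : M → Type _)

/-- The vector field `X` is of class `C^∞` at `x`. -/
def SmoothFieldAt (X : Π x : M, TangentSpace (𝓡 n) x) (x : M) : Prop :=
  ContMDiffAt (𝓡 n) (𝓡 n).tangent ∞ (fun y ↦ (⟨y, X y⟩ : TangentBundle (𝓡 n) M)) x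

/-- The vector field `X` is differentiable at `x`. -/
def DiffFieldAt (X : Π x : M, TangentSpace (𝓡 n) x) (x : M) : Prop :=
  MDifferentiableAt (𝓡 n) (𝓡 n).tangent (fun y ↦ (⟨y, X y⟩ : TangentBundle (𝓡 n) M)) x

/-- The vector field `R(X, Y) Z = ∇_X ∇_Y Z - ∇_Y ∇_X Z - ∇_{[X, Y]} Z`. -/
def curvature (D : AffineConnection n M) (X Y Z : Π x : M, TangentSpace (𝓡 n) x) (x : M) :
    TangentSpace (𝓡 n) x :=
  D (fun y ↦ D Z y (Y y)) x (X x) - D (fun y ↦ D Z y (X y)) x (Y x)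
    - D Z x (VectorField.mlieBracket (𝓡 n) X Y x)

/-- The curvature of the connection vanishes at every point. -/
def IsFlatConnection (D : AffineConnection n M) : Prop :=
  ∀ (x : M) (X Y Z : Π x : M, TangentSpace (𝓡 n) x),
    SmoothFieldAt X x → SmoothFieldAt Y x → SmoothFieldAt Z x →
      curvature D X Y Z x = 0

/-- The two connections are dual with respect to the metric:
`X g(Y, Z) = g(∇_X Y, Z) + g(Y, ∇*_X Z)`. -/
def AreDualConnections (g : SmoothMetric n M) (D D' : AffineConnection n M) : Prop :=
  ∀ (x : M) (v : TangentSpace (𝓡 n) x) (Y Z : Π x : M, TangentSpace (𝓡 n) x),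
    DiffFieldAt Y x → DiffFieldAt Z x →
      mvfderiv (𝓡 n) (fun y ↦ g.inner y (Y y) (Z y)) x v
        = g.inner x (D Y x v) (Z x) + g.inner x (Y x) (D' Z x v)

/-- `(M, g, ∇, ∇*)` is a dually flat manifold: `∇` and `∇*` are smooth affine connections, dual
with respect to the Riemannian metric `g`, and both are torsion-free and flat. -/
structure IsDuallyFlat (g : SmoothMetric n M) (D D' : AffineConnection n M) : Prop where
  smooth : D.ContMDiffCovariantDerivative ∞
  smooth' : D'.ContMDiffCovariantDerivative ∞
  dual : AreDualConnections g D D'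
  torsion_free : D.torsion = 0
  torsion_free' : D'.torsion = 0
  flat : IsFlatConnection D
  flat' : IsFlatConnection D'

/-! ### Coordinate systems -/

/-- The `i`-th coordinate vector field `∂/∂ηⁱ` of the coordinate system `η`
(meaningful on the domain of `η`): `dη` sends it to the `i`-th standard basis vector. -/
def coordField (η : OpenPartialHomeomorph M (EuclideanSpace ℝ (Fin n))) (i : Fin n) :
    Π x : M, TangentSpace (𝓡 n) x :=
  VectorField.mpullback (𝓡 n) 𝓘(ℝ, EuclideanSpace ℝ (Fin n)) η
    (fun _ ↦ EuclideanSpace.single i (1 : ℝ))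

/-- The matrix `g(∂/∂ηⁱ, ∂/∂ηʲ)` of the metric at `x` in the coordinate system `η`. -/
def metricMatrix (g : SmoothMetric n M) (η : OpenPartialHomeomorph M (EuclideanSpace ℝ (Fin n)))
    (x : M) : Matrix (Fin n) (Fin n) ℝ :=
  Matrix.of fun i j ↦ g.inner x (coordField η i x) (coordField η j x)

/-- The coordinate system `η` is `∇`-affine: its coordinate fields are parallel,
`∇_{∂ᵢ} ∂ⱼ = 0` on the domain of `η`. -/
def IsAffineCoord (D : AffineConnection n M)
    (η : OpenPartialHomeomorph M (EuclideanSpace ℝ (Fin n))) : Prop :=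
  ∀ x ∈ η.source, ∀ i j : Fin n, D (coordField η j) x (coordField η i x) = 0

/-- Two coordinate systems are mutually dual: they have the same domain and their natural bases
are biorthogonal. -/
def AreDualCoord (g : SmoothMetric n M)
    (η η' : OpenPartialHomeomorph M (EuclideanSpace ℝ (Fin n))) : Prop :=
  η.source = η'.source ∧ ∀ x ∈ η.source, ∀ i j : Fin n,
    g.inner x (coordField η i x) (coordField η' j x) = if i = j then 1 else 0

end DuallyFlat

/-! ### Monge–Ampère manifolds -/

section MongeAmpere

variable {n : ℕ}

/-- The partial derivative `∂ᵢ Φ` of a function on `ℝⁿ`. -/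
def partialDeriv (i : Fin n) (Φ : EuclideanSpace ℝ (Fin n) → ℝ) :
    EuclideanSpace ℝ (Fin n) → ℝ :=
  fun y ↦ fderiv ℝ Φ y (EuclideanSpace.single i (1 : ℝ))

/-- The Hessian matrix `(∂ᵢ ∂ⱼ Φ)`. -/
def hessian (Φ : EuclideanSpace ℝ (Fin n) → ℝ) (y : EuclideanSpace ℝ (Fin n)) :
    Matrix (Fin n) (Fin n) ℝ :=
  Matrix.of fun i j ↦ partialDeriv i (partialDeriv j Φ) y

/-- `Φ` is a smooth solution on the open set `𝒟` of the elliptic Monge–Ampère equation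
`det Hess Φ = f` with smooth positive right-hand side `f`. -/
structure SolvesMongeAmpere (𝒟 : Set (EuclideanSpace ℝ (Fin n)))
    (Φ f : EuclideanSpace ℝ (Fin n) → ℝ) : Prop where
  isOpen_domain : IsOpen 𝒟
  smooth : ContDiffOn ℝ ∞ Φ 𝒟
  smooth_rhs : ContDiffOn ℝ ∞ f 𝒟
  rhs_pos : ∀ y ∈ 𝒟, 0 < f y
  elliptic : ∀ y ∈ 𝒟, (hessian Φ y).PosDef
  det_hessian : ∀ y ∈ 𝒟, (hessian Φ y).det = f y

/-- A Monge–Ampère manifold structure on `M`: around every point `p`, a smooth coordinate system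
and a smooth potential function which, in these coordinates, solves a Monge–Ampère equation. -/
structure MongeAmpereStructure (n : ℕ) (M : Type*) [TopologicalSpace M]
    [ChartedSpace (EuclideanSpace ℝ (Fin n)) M] [IsManifold (𝓡 n) ∞ M] where
  /-- the local coordinate system around `p` -/
  coord : M → OpenPartialHomeomorph M (EuclideanSpace ℝ (Fin n))
  /-- the local potential around `p`, as a function of the coordinates -/
  potential : M → EuclideanSpace ℝ (Fin n) → ℝ
  /-- the right-hand side of the local equation around `p`, as a function of the coordinates -/
  rhs : M → EuclideanSpace ℝ (Fin n) → ℝ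
  mem_source : ∀ p, p ∈ (coord p).source
  coord_mem_atlas : ∀ p, coord p ∈ IsManifold.maximalAtlas (𝓡 n) ∞ M
  solves : ∀ p, SolvesMongeAmpere (coord p).target (potential p) (rhs p)

end MongeAmpere

end

/-! A torsion-free flat connection has affine coordinates. In a chart with Christoffel symbol `C`, a
map `η` with differential `θ` has parallel coordinate fields when `dθ(u) = θ ∘ C(u, ·)`. The pair
`(η, θ)` is thus a parallel section of a linear connection on the trivial bundle with fibre `E × (E
→L[ℝ] E)`. The curvature of that connection consists of the torsion and the curvature of `∇`, so it
vanishes and `exists_parallel_section` applies. The result is `exists_affine_chart`.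

In a `∇`-affine chart, duality reduces the derivative of the metric to `∂ᵤ g(v, w) = g(v, ∇*ᵤ w)`.
Since `∇*` has no torsion and `g` is symmetric, this is totally symmetric in `u, v, w`
(`fderiv_metricForm_symm`). Two applications of the Poincaré lemma write `g` as the Hessian of a
function `ψ` (`exists_hessian_potential`).

As the Hessian is positive definite, the gradient of `ψ` is a local diffeomorphism `τ`. The dual
coordinates are `η* = τ(η)` and `ψ*` is the Legendre transform, whose gradient is `τ⁻¹` and whose
Hessian is the inverse matrix (`exists_legendre_pair`). The fields `∂ᵢ` and `∂ʲ` are biorthogonal,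
so differentiating their constant pairing shows that `η*` is `∇*`-affine
(`covariantDerivative_eq_zero_of_dual`). The Monge–Ampère equations then hold with the determinants
of the metric matrices as right-hand sides. -/

noncomputable section

open Set Metric Filter Topology

/-! ### Parallel sections of flat linear connections on a normed space -/

section LinearFrobenius

set_option maxSynthPendingDepth 3

variable {E F : Type*} [NormedAddCommGroup E] [NormedSpace ℝ E]
  [NormedAddCommGroup F] [NormedSpace ℝ F]

/-- A linear differential equation `α' = A(t) α` with `A` small on `[0, 1]` has a solution with
prescribed initial value, bounded independently of `A`. -/
theorem exists_linear_ode_solution [CompleteSpace F] {A : ℝ → F →L[ℝ] F} (e : F)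
    (hA : ContinuousOn A (Icc 0 1)) {K : ℝ} (hK : ∀ t ∈ Icc (0 : ℝ) 1, ‖A t‖ ≤ K)
    (hsmall : K * (‖e‖ + 1) ≤ 1) :
    ∃ α : ℝ → F, α 0 = e ∧
      (∀ t ∈ Icc (0 : ℝ) 1, HasDerivWithinAt α (A t (α t)) (Icc 0 1) t) ∧
      ∀ t ∈ Icc (0 : ℝ) 1, ‖α t‖ ≤ ‖e‖ * Real.exp K := by
  have hK0 : 0 ≤ K := (norm_nonneg _).trans (hK 0 (by simp))
  -- On the ball of radius 1 about `e` the field has norm at most `K * (‖e‖ + 1) ≤ 1`, so a solution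
  -- stays in it for unit time.
  have hPL : IsPicardLindelof (fun t w ↦ A t w) (tmin := 0) (tmax := 1) ⟨0, by simp⟩ e 1 0 1
      ⟨K, hK0⟩ := by
    refine ⟨fun t ht ↦ ?_, fun x _ ↦ hA.clm_apply continuousOn_const, fun t ht x hx ↦ ?_, ?_⟩
    · refine LipschitzOnWith.of_dist_le_mul fun x _ y _ ↦ ?_
      rw [dist_eq_norm, dist_eq_norm, ← map_sub]
      exact (A t).le_of_opNorm_le (hK t ht) _
    · have hx' : ‖x‖ ≤ ‖e‖ + 1 := by
        have := norm_le_norm_add_norm_sub' x e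
        have h2 : ‖x - e‖ ≤ 1 := by simpa [dist_eq_norm] using hx
        linarith
      calc ‖A t x‖ ≤ K * ‖x‖ := (A t).le_of_opNorm_le (hK t ht) _
        _ ≤ K * (‖e‖ + 1) := by gcongr
        _ ≤ 1 := hsmall
        _ = _ := by simp
    · simp
  obtain ⟨α, h0, hα⟩ := hPL.exists_eq_forall_mem_Icc_hasDerivWithinAt₀
  refine ⟨α, h0, hα, fun t ht ↦ ?_⟩
  have hb := norm_le_gronwallBound_of_norm_deriv_right_le (f := α) (f' := fun t ↦ A t (α t))
    (δ := ‖e‖) (K := K) (ε := 0) (a := 0) (b := 1)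
    (fun t ht ↦ (hα t ht).continuousWithinAt)
    (fun t ht ↦ ((hα t ⟨ht.1, ht.2.le⟩).mono_of_mem_nhdsWithin
      (Icc_mem_nhdsGE_of_mem ht)))
    (by rw [← h0]) (fun t ht ↦ by
      simpa using (A t).le_of_opNorm_le (hK t ⟨ht.1, ht.2.le⟩) _) t ht
  rw [gronwallBound_ε0] at hb
  refine hb.trans ?_
  gcongr
  nlinarith [ht.2]

/-- The remainder estimate behind the linear Frobenius theorem: the solutions along two nearby
rays differ to first order by the connection form. -/
theorem ray_solution_sub_le {Γ : E → E →L[ℝ] F →L[ℝ] F}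
    {Γ' : E → E →L[ℝ] E →L[ℝ] F →L[ℝ] F} {r B L N : ℝ}
    (hΓ' : ∀ y ∈ ball (0 : E) r, HasFDerivAt Γ (Γ' y) y)
    (hB : ∀ y ∈ ball (0 : E) r, ‖Γ y‖ ≤ B)
    (hL : ∀ y ∈ ball (0 : E) r, ∀ z ∈ ball (0 : E) r, ‖Γ z - Γ y‖ ≤ L * ‖z - y‖)
    (hN : ∀ y ∈ ball (0 : E) r, ∀ z ∈ ball (0 : E) r,
      ‖Γ z - Γ y - Γ' y (z - y)‖ ≤ N * ‖z - y‖ ^ 2)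
    (hflat : ∀ y ∈ ball (0 : E) r, ∀ u v,
      Γ' y u v + Γ y v ∘L Γ y u = Γ' y v u + Γ y u ∘L Γ y v)
    {x v : E} (hx : x ∈ ball (0 : E) r) (hxv : x + v ∈ ball (0 : E) r) {α β : ℝ → F} {C : ℝ}
    (hα : ∀ t ∈ Icc (0 : ℝ) 1, HasDerivWithinAt α (Γ (t • x) x (α t)) (Icc 0 1) t)
    (hβ : ∀ t ∈ Icc (0 : ℝ) 1,
      HasDerivWithinAt β (Γ (t • (x + v)) (x + v) (β t)) (Icc 0 1) t)
    (h0 : β 0 = α 0) (hC : ∀ t ∈ Icc (0 : ℝ) 1, ‖α t‖ ≤ C) :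
    ‖β 1 - α 1 - Γ x v (α 1)‖ ≤
      ((L * r + B) * B + L + N * r) * C * ‖v‖ ^ 2 * Real.exp (B * r + 1) := by
  have hr : 0 < r := pos_of_mem_ball hx
  have hB0 : 0 ≤ B := (norm_nonneg _).trans (hB x hx)
  have hC0 : 0 ≤ C := (norm_nonneg _).trans (hC 0 (by simp))
  have hseg : ∀ z ∈ ball (0 : E) r, ∀ t ∈ Icc (0 : ℝ) 1, t • z ∈ ball (0 : E) r := by
    intro z hz t ht
    have hz' : ‖z‖ < r := by simpa using hz
    have : ‖t • z‖ < r := by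
      rw [norm_smul, Real.norm_of_nonneg ht.1]
      nlinarith [norm_nonneg z, ht.1, ht.2]
    simpa using this
  have hxr : ‖x‖ ≤ r := by simpa using (mem_ball_zero_iff.1 hx).le
  have hxvr : ‖x + v‖ ≤ r := by simpa using (mem_ball_zero_iff.1 hxv).le
  -- The term `t • Γ (t • x) v (α t)` is the expected first variation of the ray solution when `x`
  -- moves by `v`; `R` is the error of this guess.
  set R : ℝ → F := fun t ↦ β t - α t - t • Γ (t • x) v (α t) with hR
  set R' : ℝ → F := fun t ↦ Γ (t • (x + v)) (x + v) (β t) - Γ (t • x) x (α t) -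
    (t • (Γ (t • x) v (Γ (t • x) x (α t)) + Γ' (t • x) x v (α t)) +
      Γ (t • x) v (α t)) with hR'
  have hder : ∀ t ∈ Icc (0 : ℝ) 1, HasDerivWithinAt R (R' t) (Icc 0 1) t := by
    intro t ht
    have h1 : HasDerivWithinAt (fun t : ℝ ↦ Γ (t • x)) (Γ' (t • x) x) (Icc 0 1) t := by
      have h2 : HasDerivAt (fun t : ℝ ↦ t • x) x t := by
        simpa using (hasDerivAt_id t).smul_const x
      exact ((hΓ' _ (hseg x hx t ht)).comp_hasDerivAt t h2).hasDerivWithinAt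
    have h3 : HasDerivWithinAt (fun t : ℝ ↦ Γ (t • x) v) (Γ' (t • x) x v) (Icc 0 1) t := by
      simpa using h1.clm_apply (hasDerivWithinAt_const t (Icc 0 1) v)
    have h4 := (hasDerivWithinAt_id t (Icc (0 : ℝ) 1)).smul (h3.clm_apply (hα t ht))
    have h5 := ((hβ t ht).sub (hα t ht)).sub h4
    refine h5.congr_deriv ?_
    simp only [hR', id, one_smul]
    congr 3
    abel
  -- Flatness exchanges `Γ' x v` for `Γ' v x` up to a commutator. The new term is the linear Taylor
  -- term of `Γ` from `t • x` to `t • (x + v)`, so `R` solves the linear equation up to terms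
  -- quadratic in `v`.
  have hkey : ∀ t ∈ Icc (0 : ℝ) 1, R' t = Γ (t • (x + v)) (x + v) (R t) +
      (t • (Γ (t • (x + v)) - Γ (t • x)) (x + v) (Γ (t • x) v (α t)) +
        t • Γ (t • x) v (Γ (t • x) v (α t)) +
      (Γ (t • (x + v)) - Γ (t • x)) v (α t) +
      (Γ (t • (x + v)) - Γ (t • x) - Γ' (t • x) (t • (x + v) - t • x)) x (α t)) := by
    intro t ht
    have hf := congr($(hflat _ (hseg x hx t ht) x v) (α t))
    simp only [add_apply, ContinuousLinearMap.comp_apply] at hf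
    have h6 : t • (x + v) - t • x = t • v := by module
    have h7 : Γ' (t • x) x v (α t) = Γ' (t • x) v x (α t) + Γ (t • x) x (Γ (t • x) v (α t))
        - Γ (t • x) v (Γ (t • x) x (α t)) := by
      rw [← hf]; abel
    simp only [hR, hR', h6, h7, map_sub, map_add, map_smul, sub_apply,
      add_apply, smul_apply]
    module
  have hbound : ∀ t ∈ Icc (0 : ℝ) 1, ‖R' t‖ ≤ (B * r + 1) * ‖R t‖ +
      ((L * r + B) * B + L + N * r) * C * ‖v‖ ^ 2 := by
    intro t ht
    have hy := hseg x hx t ht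
    have hz := hseg _ hxv t ht
    have hd : ‖t • (x + v) - t • x‖ ≤ ‖v‖ := by
      have h6 : t • (x + v) - t • x = t • v := by module
      rw [h6, norm_smul, Real.norm_of_nonneg ht.1]
      nlinarith [norm_nonneg v, ht.2]
    have hL0 : 0 ≤ L * ‖v‖ := by
      have := (norm_nonneg _).trans (hL x hx (x + v) hxv)
      simpa using this
    have hN0 : 0 ≤ N * ‖v‖ ^ 2 := by
      have := (norm_nonneg _).trans (hN x hx (x + v) hxv)
      simpa using this
    have hLd : ‖Γ (t • (x + v)) - Γ (t • x)‖ ≤ L * ‖v‖ := by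
      refine (hL _ hy _ hz).trans ?_
      have h6 : t • (x + v) - t • x = t • v := by module
      rw [h6, norm_smul, Real.norm_of_nonneg ht.1]
      nlinarith [ht.2]
    have hNd : ‖Γ (t • (x + v)) - Γ (t • x) - Γ' (t • x) (t • (x + v) - t • x)‖
        ≤ N * ‖v‖ ^ 2 := by
      refine (hN _ hy _ hz).trans ?_
      have h6 : t • (x + v) - t • x = t • v := by module
      rw [h6, norm_smul, Real.norm_of_nonneg ht.1]
      have : t ^ 2 ≤ 1 := by nlinarith [ht.1, ht.2]
      nlinarith
    have hw : ‖α t‖ ≤ C := hC t ht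
    have hBv : ‖Γ (t • x) v (α t)‖ ≤ B * ‖v‖ * C :=
      ((Γ (t • x)).le_of_opNorm₂_le_of_le (hB _ hy) le_rfl hw)
    rw [hkey t ht]
    have e1 : ‖Γ (t • (x + v)) (x + v) (R t)‖ ≤ (B * r + 1) * ‖R t‖ := by
      calc _ ≤ B * r * ‖R t‖ := (Γ (t • (x + v))).le_of_opNorm₂_le_of_le (hB _ hz) hxvr le_rfl
        _ ≤ _ := by nlinarith [norm_nonneg (R t)]
    have hts : ∀ w : F, ‖t • w‖ ≤ ‖w‖ := fun w ↦ by
      rw [norm_smul, Real.norm_of_nonneg ht.1]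
      nlinarith [norm_nonneg w, ht.2]
    have e2 : ‖t • (Γ (t • (x + v)) - Γ (t • x)) (x + v) (Γ (t • x) v (α t))‖ ≤
        L * ‖v‖ * r * (B * ‖v‖ * C) :=
      (hts _).trans ((Γ (t • (x + v)) - Γ (t • x)).le_of_opNorm₂_le_of_le hLd hxvr hBv)
    have e3 : ‖t • Γ (t • x) v (Γ (t • x) v (α t))‖ ≤ B * ‖v‖ * (B * ‖v‖ * C) :=
      (hts _).trans ((Γ (t • x)).le_of_opNorm₂_le_of_le (hB _ hy) le_rfl hBv)
    have e4 : ‖(Γ (t • (x + v)) - Γ (t • x)) v (α t)‖ ≤ L * ‖v‖ * ‖v‖ * C :=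
      (Γ (t • (x + v)) - Γ (t • x)).le_of_opNorm₂_le_of_le hLd le_rfl hw
    have e5 : ‖(Γ (t • (x + v)) - Γ (t • x) - Γ' (t • x) (t • (x + v) - t • x)) x (α t)‖ ≤
        N * ‖v‖ ^ 2 * r * C :=
      ContinuousLinearMap.le_of_opNorm₂_le_of_le _ hNd hxr hw
    calc _ ≤ _ := norm_add_le_of_le e1 (norm_add_le_of_le (norm_add_le_of_le
          (norm_add_le_of_le e2 e3) e4) e5)
      _ = _ := by ring
  have hg := norm_le_gronwallBound_of_norm_deriv_right_le (f := R) (f' := R')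
    (δ := 0) (K := B * r + 1) (ε := ((L * r + B) * B + L + N * r) * C * ‖v‖ ^ 2) (a := 0) (b := 1)
    (fun t ht ↦ (hder t ht).continuousWithinAt)
    (fun t ht ↦ ((hder t ⟨ht.1, ht.2.le⟩).mono_of_mem_nhdsWithin (Icc_mem_nhdsGE_of_mem ht)))
    (by simp [hR, h0]) (fun t ht ↦ hbound t ⟨ht.1, ht.2.le⟩) 1 (by simp)
  -- Grönwall with zero initial value divides by its rate. The summand 1 in `B * r + 1` keeps the
  -- rate at least 1, so the quotient can be dropped.
  have hK1 : 1 ≤ B * r + 1 := by nlinarith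
  have hε : 0 ≤ ((L * r + B) * B + L + N * r) * C * ‖v‖ ^ 2 := by
    have h1 := hbound 0 (by simp)
    have h2 : R 0 = 0 := by simp [hR, h0]
    rw [h2] at h1
    simpa using (norm_nonneg _).trans h1
  rw [gronwallBound_of_K_ne_0 (by positivity)] at hg
  have hR1 : R 1 = β 1 - α 1 - Γ x v (α 1) := by simp [hR]
  rw [hR1] at hg
  refine hg.trans ?_
  have hexp := Real.exp_pos (B * r + 1)
  simp only [zero_mul, zero_add, sub_zero, mul_one]
  rw [div_mul_eq_mul_div, div_le_iff₀ (by positivity)]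
  nlinarith [mul_nonneg hε hexp.le]

/-- Linear Frobenius theorem at the origin: a connection form without curvature on a normed space
has parallel sections with prescribed initial value. -/
theorem exists_parallel_section_zero [CompleteSpace F] {Γ : E → E →L[ℝ] F →L[ℝ] F}
    (hΓ : ContDiffAt ℝ 2 Γ 0)
    (hflat : ∀ᶠ y in 𝓝 (0 : E), ∀ u v,
      fderiv ℝ Γ y u v + Γ y v ∘L Γ y u = fderiv ℝ Γ y v u + Γ y u ∘L Γ y v) (e : F) :
    ∃ s : E → F, s 0 = e ∧ ∀ᶠ y in 𝓝 (0 : E), HasFDerivAt s ((Γ y).flip (s y)) y := by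
  obtain ⟨L, t₁, ht₁, hL⟩ := (hΓ.of_le (by norm_num)).exists_lipschitzOnWith
  have hΓ' : ContDiffAt ℝ 1 (fderiv ℝ Γ) 0 := hΓ.fderiv_right (by norm_num)
  obtain ⟨N, t₂, ht₂, hN⟩ := hΓ'.exists_lipschitzOnWith
  have hd : ∀ᶠ y in 𝓝 (0 : E), DifferentiableAt ℝ Γ y :=
    ((hΓ.eventually (by simp)).mono fun y hy ↦ hy.differentiableAt (by norm_num))
  have hb : ∀ᶠ y in 𝓝 (0 : E), ‖Γ y‖ < ‖Γ 0‖ + 1 :=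
    hΓ.continuousAt.norm.eventually_lt continuousAt_const (by simp)
  obtain ⟨r₀, hr₀, hball⟩ := Metric.eventually_nhds_iff_ball.1
    (hflat.and (hd.and (hb.and (Filter.Eventually.and ht₁ ht₂))))
  set B : ℝ := ‖Γ 0‖ + 1 with hBdef
  have hB0 : 0 < B := by positivity
  -- Along a ray in the ball of radius `r` the coefficient `Γ (t • x) x` has norm at most `B * r`,
  -- so this is the smallness required by `exists_linear_ode_solution`.
  obtain ⟨r, hr, hrr₀, hrB⟩ : ∃ r : ℝ, 0 < r ∧ r ≤ r₀ ∧ B * r * (‖e‖ + 1) ≤ 1 := by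
    refine ⟨min r₀ (1 / (B * (‖e‖ + 1))), by positivity, min_le_left _ _, ?_⟩
    have := min_le_right r₀ (1 / (B * (‖e‖ + 1)))
    rw [le_div_iff₀ (by positivity)] at this
    linarith
  replace hball : ∀ y ∈ ball (0 : E) r, _ := fun y hy ↦ hball y (ball_subset_ball hrr₀ hy)
  have hder : ∀ y ∈ ball (0 : E) r, HasFDerivAt Γ (fderiv ℝ Γ y) y :=
    fun y hy ↦ (hball y hy).2.1.hasFDerivAt
  have hBb : ∀ y ∈ ball (0 : E) r, ‖Γ y‖ ≤ B := fun y hy ↦ (hball y hy).2.2.1.le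
  have hLb : ∀ y ∈ ball (0 : E) r, ∀ z ∈ ball (0 : E) r, ‖Γ z - Γ y‖ ≤ L * ‖z - y‖ := by
    intro y hy z hz
    simpa [dist_eq_norm] using hL.dist_le_mul z (hball z hz).2.2.2.1 y (hball y hy).2.2.2.1
  have hNb : ∀ y ∈ ball (0 : E) r, ∀ z ∈ ball (0 : E) r,
      ‖Γ z - Γ y - fderiv ℝ Γ y (z - y)‖ ≤ N * ‖z - y‖ ^ 2 := by
    intro y hy z hz
    have hsub : segment ℝ y z ⊆ ball (0 : E) r := (convex_ball (0 : E) r).segment_subset hy hz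
    have := (convex_segment (𝕜 := ℝ) y z).norm_image_sub_le_of_norm_hasFDerivWithin_le'
      (f := Γ) (f' := fderiv ℝ Γ) (φ := fderiv ℝ Γ y) (C := N * ‖z - y‖)
      (fun w hw ↦ (hder w (hsub hw)).hasFDerivWithinAt) (fun w hw ↦ by
        have h1 := hN.dist_le_mul w (hball w (hsub hw)).2.2.2.2 y (hball y hy).2.2.2.2
        rw [dist_eq_norm, dist_eq_norm] at h1
        refine h1.trans ?_
        gcongr
        exact norm_sub_le_of_mem_segment hw)
      (left_mem_segment ℝ y z) (right_mem_segment ℝ y z)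
    rw [pow_two, ← mul_assoc]
    exact this
  have hseg : ∀ z ∈ ball (0 : E) r, ∀ t ∈ Icc (0 : ℝ) 1, t • z ∈ ball (0 : E) r := by
    intro z hz t ht
    exact (convex_ball (0 : E) r).smul_mem_of_zero_mem (mem_ball_self hr) hz ht
  have hsol : ∀ x ∈ ball (0 : E) r, ∃ α : ℝ → F, α 0 = e ∧
      (∀ t ∈ Icc (0 : ℝ) 1, HasDerivWithinAt α (Γ (t • x) x (α t)) (Icc 0 1) t) ∧
      ∀ t ∈ Icc (0 : ℝ) 1, ‖α t‖ ≤ ‖e‖ * Real.exp (B * r) := by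
    intro x hx
    refine exists_linear_ode_solution (A := fun t ↦ Γ (t • x) x) e ?_ (fun t ht ↦ ?_) hrB
    · intro t ht
      have h1 : ContinuousAt Γ (t • x) := (hder _ (hseg x hx t ht)).continuousAt
      have h2 : ContinuousAt (fun t : ℝ ↦ Γ (t • x)) t :=
        ContinuousAt.comp (f := fun t : ℝ ↦ t • x) h1 (by fun_prop)
      exact (h2.clm_apply continuousAt_const).continuousWithinAt
    · exact (Γ (t • x)).le_of_opNorm_le_of_le (hBb _ (hseg x hx t ht))
        (by simpa using (mem_ball_zero_iff.1 hx).le)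
  choose! α h0 hα hαb using hsol
  -- The section is obtained by parallel transport of `e` along the ray from the origin to `x`. At
  -- `x = 0` the equation reads `α' = 0`.
  refine ⟨fun x ↦ α x 1, ?_, ?_⟩
  · have hc := (convex_Icc (0 : ℝ) 1).norm_image_sub_le_of_norm_hasDerivWithin_le (C := 0)
      (hα 0 (mem_ball_self hr)) (by simp) (x := 0) (y := 1) (by simp) (by simp)
    rw [h0 0 (mem_ball_self hr)] at hc
    simpa [sub_eq_zero] using hc
  · filter_upwards [ball_mem_nhds (0 : E) hr] with x hx
    rw [hasFDerivAt_iff_isLittleO_nhds_zero]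
    have hO : (fun v ↦ α (x + v) 1 - α x 1 - (Γ x).flip (α x 1) v) =O[𝓝 0]
        fun v : E ↦ ‖v‖ ^ 2 := by
      refine Asymptotics.IsBigO.of_bound (((L * r + B) * B + L + N * r) *
        (‖e‖ * Real.exp (B * r)) * Real.exp (B * r + 1)) ?_
      have hmem : ∀ᶠ v in 𝓝 (0 : E), x + v ∈ ball (0 : E) r := by
        have : Tendsto (fun v : E ↦ x + v) (𝓝 0) (𝓝 x) := by
          simpa using (continuous_const_add x).tendsto (0 : E)
        exact this (isOpen_ball.mem_nhds hx)
      filter_upwards [hmem] with v hv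
      have := ray_solution_sub_le hder hBb hLb hNb (fun y hy ↦ (hball y hy).1) hx hv (hα x hx)
        (hα _ hv) ((h0 _ hv).trans (h0 _ hx).symm) (hαb x hx)
      rw [ContinuousLinearMap.flip_apply]
      refine this.trans (le_of_eq ?_)
      simp only [norm_pow, norm_norm]
      ring
    refine hO.trans_isLittleO ?_
    simpa using! (Asymptotics.isLittleO_norm_pow_id (E' := E) one_lt_two)

/-- Linear Frobenius theorem: a connection form without curvature has parallel sections with
prescribed initial value. -/
theorem exists_parallel_section [CompleteSpace F] {Γ : E → E →L[ℝ] F →L[ℝ] F} {x₀ : E}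
    (hΓ : ContDiffAt ℝ 2 Γ x₀)
    (hflat : ∀ᶠ y in 𝓝 x₀, ∀ u v,
      fderiv ℝ Γ y u v + Γ y v ∘L Γ y u = fderiv ℝ Γ y v u + Γ y u ∘L Γ y v) (e : F) :
    ∃ s : E → F, s x₀ = e ∧ ∀ᶠ y in 𝓝 x₀, HasFDerivAt s ((Γ y).flip (s y)) y := by
  have ht : Tendsto (fun z : E ↦ z + x₀) (𝓝 0) (𝓝 x₀) := by
    simpa using (continuous_add_const x₀).tendsto (0 : E)
  have ht' : Tendsto (fun z : E ↦ z - x₀) (𝓝 x₀) (𝓝 0) := by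
    simpa using (continuous_sub_right x₀).tendsto x₀
  obtain ⟨s, h0, hs⟩ := exists_parallel_section_zero (Γ := fun z ↦ Γ (z + x₀)) (e := e)
    (ContDiffAt.comp (0 : E) (by simpa using hΓ) (contDiffAt_id.add contDiffAt_const))
    (by simp only [fderiv_comp_add_right]; exact ht.eventually hflat)
  refine ⟨fun y ↦ s (y - x₀), by simpa using h0, ?_⟩
  filter_upwards [ht'.eventually hs] with y hy
  rw [sub_add_cancel] at hy
  exact (HasFDerivAt.comp y hy ((hasFDerivAt_id y).sub_const x₀)).congr_fderiv
    (ContinuousLinearMap.comp_id _)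

/-- A parallel section of a smooth connection form is smooth. -/
theorem contDiffAt_of_hasFDerivAt_flip {Γ : E → E →L[ℝ] F →L[ℝ] F} {s : E → F} {x₀ : E}
    (hΓ : ContDiffAt ℝ ∞ Γ x₀)
    (hs : ∀ᶠ y in 𝓝 x₀, HasFDerivAt s ((Γ y).flip (s y)) y) : ContDiffAt ℝ ∞ s x₀ := by
  rw [contDiffAt_infty]
  intro k
  -- Bootstrapping: the derivative `(Γ y).flip (s y)` is as regular as `s`, so `s` gains one order
  -- at each step.
  induction k with
  | zero =>
    rw [Nat.cast_zero, contDiffAt_zero]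
    exact ⟨_, hs, fun y hy ↦ (HasFDerivAt.continuousAt hy).continuousWithinAt⟩
  | succ k ih =>
    rw [Nat.cast_succ, contDiffAt_succ_iff_hasFDerivAt]
    refine ⟨fun y ↦ (Γ y).flip (s y), ⟨_, hs, fun y hy ↦ hy⟩, ?_⟩
    have h1 : ContDiffAt ℝ k (fun y ↦ (Γ y).flip) x₀ :=
      (ContinuousLinearMap.flipₗᵢ ℝ E F F).contDiff.contDiffAt.comp x₀
        (contDiffAt_infty.1 hΓ k)
    exact h1.clm_apply ih

end LinearFrobenius

/-! ### Affine coordinates of a flat torsion-free connection on a vector space -/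

section AffineCoordinates

set_option maxSynthPendingDepth 3

variable {E : Type*} [NormedAddCommGroup E] [NormedSpace ℝ E]

/-- The connection form on `E × (E →L[ℝ] E)` whose parallel sections `(η, θ)` are the maps `η` with
differential `θ` parallel for the affine connection with Christoffel symbol `C`. -/
def jetConnection (C : E → E →L[ℝ] E →L[ℝ] E) (y : E) :
    E →L[ℝ] (E × (E →L[ℝ] E)) →L[ℝ] (E × (E →L[ℝ] E)) :=
  (ContinuousLinearMap.compL ℝ (E × (E →L[ℝ] E)) (E →L[ℝ] E) (E × (E →L[ℝ] E))).flip
      (ContinuousLinearMap.snd ℝ E (E →L[ℝ] E)) ∘L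
    (ContinuousLinearMap.compL ℝ (E →L[ℝ] E) E (E × (E →L[ℝ] E))
        (ContinuousLinearMap.inl ℝ E (E →L[ℝ] E)) ∘L ContinuousLinearMap.apply ℝ E +
      ContinuousLinearMap.compL ℝ (E →L[ℝ] E) (E →L[ℝ] E) (E × (E →L[ℝ] E))
        (ContinuousLinearMap.inr ℝ E (E →L[ℝ] E)) ∘L
        (ContinuousLinearMap.compL ℝ E E E).flip ∘L C y)

theorem jetConnection_apply (C : E → E →L[ℝ] E →L[ℝ] E) (y v : E) (w : E × (E →L[ℝ] E)) :
    jetConnection C y v w = (w.2 v, w.2 ∘L C y v) := by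
  simp [jetConnection]

/-- `jetConnection C y` is an affine function of `C y` with constant coefficients; its definition by
composition operators makes this visible. -/
theorem ContDiffAt.jetConnection {C : E → E →L[ℝ] E →L[ℝ] E} {k : WithTop ℕ∞} {y : E}
    (hC : ContDiffAt ℝ k C y) : ContDiffAt ℝ k (jetConnection C) y := by
  unfold _root_.jetConnection
  exact contDiffAt_const.clm_comp (contDiffAt_const.add
    (contDiffAt_const.clm_comp (contDiffAt_const.clm_comp hC)))

theorem fderiv_jetConnection_apply {C : E → E →L[ℝ] E →L[ℝ] E} {y : E}
    (hC : ContDiffAt ℝ 1 C y) (u v : E) (w : E × (E →L[ℝ] E)) :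
    fderiv ℝ (jetConnection C) y u v w = (0, w.2 ∘L fderiv ℝ C y u v) := by
  have h1 := hC.jetConnection.differentiableAt one_ne_zero
  have h2 := hC.differentiableAt one_ne_zero
  have e1 := (h1.hasFDerivAt.clm_apply (hasFDerivAt_const v y)).clm_apply (hasFDerivAt_const w y)
  have e2 := (hasFDerivAt_const (w.2 v) y).prodMk ((hasFDerivAt_const w.2 y).clm_comp
    (h2.hasFDerivAt.clm_apply (hasFDerivAt_const v y)))
  simp only [jetConnection_apply] at e1
  simpa using congr($(e1.unique e2) u)

/-- A torsion-free affine connection of zero curvature on an open set of a vector space has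
affine coordinates. -/
theorem exists_affine_map [CompleteSpace E] {C : E → E →L[ℝ] E →L[ℝ] E} {x₀ : E}
    (hC : ∀ᶠ y in 𝓝 x₀, ContDiffAt ℝ ∞ C y) (htor : ∀ᶠ y in 𝓝 x₀, ∀ u v, C y u v = C y v u)
    (hcurv : ∀ᶠ y in 𝓝 x₀, ∀ u v w,
      fderiv ℝ C y u v w + C y u (C y v w) = fderiv ℝ C y v u w + C y v (C y u w)) :
    ∃ η : E → E, ∃ θ : E → E →L[ℝ] E, θ x₀ = ContinuousLinearMap.id ℝ E ∧
      ∀ᶠ y in 𝓝 x₀, ContDiffAt ℝ ∞ η y ∧ ContDiffAt ℝ ∞ θ y ∧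
        HasFDerivAt η (θ y) y ∧ ∀ u, fderiv ℝ θ y u = θ y ∘L C y u := by
  have hC1 : ∀ᶠ y in 𝓝 x₀, ContDiffAt ℝ 1 C y :=
    hC.mono fun y hy ↦ contDiffAt_infty.1 hy 1
  obtain ⟨s, hs0, hs⟩ := exists_parallel_section (Γ := jetConnection C) (x₀ := x₀)
    (contDiffAt_infty.1 hC.self_of_nhds.jetConnection 2) (by
      filter_upwards [htor, hcurv, hC1] with y h1 h2 h3 u v
      refine ContinuousLinearMap.ext fun w ↦ ?_
      simp only [add_apply, ContinuousLinearMap.comp_apply, fderiv_jetConnection_apply h3,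
        jetConnection_apply]
      refine Prod.ext ?_ ?_
      -- The first component of flatness is the vanishing of the torsion, the second the vanishing
      -- of the curvature, each composed with `w.2`.
      · simp [h1 u v]
      · ext z
        simpa using congr(w.2 $(h2 u v z)))
    (0, ContinuousLinearMap.id ℝ E)
  refine ⟨fun y ↦ (s y).1, fun y ↦ (s y).2, by simp [hs0], ?_⟩
  filter_upwards [hs, hs.eventually_nhds, hC] with y hy hy' hCy
  have hsm := contDiffAt_of_hasFDerivAt_flip hCy.jetConnection hy'
  refine ⟨contDiffAt_fst.comp y hsm, contDiffAt_snd.comp y hsm, ?_, ?_⟩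
  · refine hy.fst.congr_fderiv ?_
    ext v
    simp [jetConnection_apply]
  · intro u
    rw [hy.snd.fderiv]
    simp [jetConnection_apply]

/-- A smooth map with invertible differential at a point restricts to a local diffeomorphism
near that point. -/
theorem exists_openPartialHomeomorph_of_contDiffOn [CompleteSpace E] {f : E → E} {V : Set E}
    (hV : IsOpen V) (hf : ContDiffOn ℝ ∞ f V) (hinv : ∀ y ∈ V, (fderiv ℝ f y).IsInvertible) {x₀ : E}
    (hx₀ : x₀ ∈ V) :
    ∃ τ : OpenPartialHomeomorph E E, x₀ ∈ τ.source ∧ τ.source ⊆ V ∧ (∀ y, τ y = f y) ∧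
      ContDiffOn ℝ ∞ τ.symm τ.target := by
  have hfx : ContDiffAt ℝ ∞ f x₀ := hf.contDiffAt (hV.mem_nhds hx₀)
  obtain ⟨e, he⟩ := hinv x₀ hx₀
  have hd : HasFDerivAt f (e : E →L[ℝ] E) x₀ := by
    rw [he]; exact (hfx.differentiableAt (by simp)).hasFDerivAt
  have hsrc : ((hfx.toOpenPartialHomeomorph f hd (by simp)).restrOpen V hV).source ⊆ V :=
    fun y hy ↦ hy.2
  refine ⟨(hfx.toOpenPartialHomeomorph f hd (by simp)).restrOpen V hV,
    ⟨hfx.mem_toOpenPartialHomeomorph_source hd (by simp), hx₀⟩, hsrc, fun y ↦ rfl, ?_⟩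
  -- The inverse function theorem at `x₀` alone does not make the inverse smooth on the whole
  -- target; invertibility throughout `V` does, point by point.
  intro z hz
  have hy := hsrc (OpenPartialHomeomorph.map_target _ hz)
  obtain ⟨e', he'⟩ := hinv _ hy
  have hfy := hf.contDiffAt (hV.mem_nhds hy)
  refine (OpenPartialHomeomorph.contDiffAt_symm _ hz (f₀' := e') ?_ hfy).contDiffWithinAt
  rw [he']
  exact (hfy.differentiableAt (by simp)).hasFDerivAt

end AffineCoordinates

/-! ### Hessian potentials -/

section Potential

set_option maxSynthPendingDepth 3

variable {E F : Type*} [NormedAddCommGroup E] [NormedSpace ℝ E]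
  [NormedAddCommGroup F] [NormedSpace ℝ F]

theorem contDiffOn_infty_of_hasFDerivAt {f : E → F} {f' : E → E →L[ℝ] F} {V : Set E}
    (hV : IsOpen V) (hf : ∀ y ∈ V, HasFDerivAt f (f' y) y) (hf' : ContDiffOn ℝ ∞ f' V) :
    ContDiffOn ℝ ∞ f V := by
  rw [contDiffOn_infty_iff_fderiv_of_isOpen hV]
  exact ⟨fun y hy ↦ (hf y hy).differentiableAt.differentiableWithinAt,
    hf'.congr fun y hy ↦ (hf y hy).fderiv⟩

/-- A symmetric 2-tensor whose derivative is totally symmetric is the Hessian of a function. -/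
theorem exists_hessian_potential {G : E → E →L[ℝ] E →L[ℝ] ℝ} {V : Set E} (hV : IsOpen V)
    (hconv : Convex ℝ V) (hG : ContDiffOn ℝ ∞ G V)
    (hsymm : ∀ y ∈ V, ∀ u v, G y u v = G y v u)
    (hcodazzi : ∀ y ∈ V, ∀ u v w, fderiv ℝ G y u v w = fderiv ℝ G y v u w) :
    ∃ (l : E → E →L[ℝ] ℝ) (ψ : E → ℝ), ContDiffOn ℝ ∞ l V ∧ ContDiffOn ℝ ∞ ψ V ∧
      ∀ y ∈ V, HasFDerivAt l (G y) y ∧ HasFDerivAt ψ (l y) y := by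
  -- The Poincaré lemma is used twice: `hcodazzi` says that `G` is closed as a 1-form with values in
  -- the dual space, and then `hsymm` says that its primitive `l` is closed.
  obtain ⟨l, hl⟩ := hconv.exists_forall_hasFDerivAt_of_fderiv_symmetric hV
    (hG.differentiableOn (by simp)) (fun y hy u v ↦ by ext w; exact hcodazzi y hy u v w)
  obtain ⟨ψ, hψ⟩ := hconv.exists_forall_hasFDerivAt_of_fderiv_symmetric hV
    (fun y hy ↦ (hl y hy).differentiableAt.differentiableWithinAt)
    (fun y hy u v ↦ by rw [(hl y hy).fderiv]; exact hsymm y hy u v)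
  have hls := contDiffOn_infty_of_hasFDerivAt hV hl hG
  exact ⟨l, ψ, hls, contDiffOn_infty_of_hasFDerivAt hV hψ hls, fun y hy ↦ ⟨hl y hy, hψ y hy⟩⟩

end Potential

/-! ### Vector fields read in a chart -/

section ChartFields

set_option maxSynthPendingDepth 3
set_option linter.unusedSectionVars false

variable {E : Type*} [NormedAddCommGroup E] [NormedSpace ℝ E]
  {M : Type*} [TopologicalSpace M] [ChartedSpace E M]
  {η : OpenPartialHomeomorph M E} {x : M}

theorem two_le_infty : (2 : ℕ∞ω) ≤ ∞ := WithTop.coe_le_coe.2 le_top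

/-- The vector field on `M` which in the chart `η` is given by the map `W`. -/
def chartLift (η : OpenPartialHomeomorph M E) (W : E → E) (x : M) : TangentSpace 𝓘(ℝ, E) x :=
  VectorField.mpullback 𝓘(ℝ, E) 𝓘(ℝ, E) η W x

/-- The vector field on `M` which in the chart `η` is constant, equal to `v`. -/
def chartField (η : OpenPartialHomeomorph M E) (v : E) (x : M) : TangentSpace 𝓘(ℝ, E) x :=
  chartLift η (fun _ ↦ v) x

/-- The components of a vector field in the chart `η`. -/
def chartRep (η : OpenPartialHomeomorph M E) (Z : Π x : M, TangentSpace 𝓘(ℝ, E) x) (y : E) : E :=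
  VectorField.mpullback 𝓘(ℝ, E) 𝓘(ℝ, E) η.symm Z y

theorem chartLift_eq_chartField (η : OpenPartialHomeomorph M E) (W : E → E) (x : M) :
    chartLift η W x = chartField η (W (η x)) x := rfl

theorem chartField_apply (η : OpenPartialHomeomorph M E) (v : E) (x : M) :
    chartField η v x = (mfderiv 𝓘(ℝ, E) 𝓘(ℝ, E) η x).inverse v := rfl

theorem chartField_add (u v : E) : chartField η (u + v) x = chartField η u x + chartField η v x :=
  map_add (mfderiv 𝓘(ℝ, E) 𝓘(ℝ, E) η x).inverse u v

theorem chartField_zero : chartField η (0 : E) x = 0 :=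
  map_zero (mfderiv 𝓘(ℝ, E) 𝓘(ℝ, E) η x).inverse

theorem chartField_smul (c : ℝ) (v : E) : chartField η (c • v) x = c • chartField η v x :=
  map_smul (mfderiv 𝓘(ℝ, E) 𝓘(ℝ, E) η x).inverse c v

theorem chartField_sum {ι : Type*} (s : Finset ι) (v : ι → E) :
    chartField η (∑ i ∈ s, v i) x = ∑ i ∈ s, chartField η (v i) x :=
  map_sum (mfderiv 𝓘(ℝ, E) 𝓘(ℝ, E) η x).inverse v s

theorem mdifferentiableAt_vectorField {W : E → E} {y : E} (hW : DifferentiableAt ℝ W y) :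
    MDifferentiableAt 𝓘(ℝ, E) 𝓘(ℝ, E).tangent
      (fun y ↦ (⟨y, W y⟩ : TangentBundle 𝓘(ℝ, E) E)) y := by
  rw [mdifferentiableAt_totalSpace]
  exact ⟨mdifferentiableAt_id, by simpa using! hW.mdifferentiableAt⟩

variable [IsManifold 𝓘(ℝ, E) ∞ M]

section

variable (he : η ∈ IsManifold.maximalAtlas 𝓘(ℝ, E) ∞ M) (hx : x ∈ η.source)
include he hx

theorem isInvertible_mfderiv_of_mem_maximalAtlas :
    (mfderiv 𝓘(ℝ, E) 𝓘(ℝ, E) η x).IsInvertible := by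
  have h : η.MDifferentiable 𝓘(ℝ, E) 𝓘(ℝ, E) :=
    ⟨(contMDiffOn_of_mem_maximalAtlas he).mdifferentiableOn (by simp),
      (contMDiffOn_symm_of_mem_maximalAtlas he).mdifferentiableOn (by simp)⟩
  exact ⟨h.mfderiv hx, rfl⟩

theorem mfderiv_symm_eq_inverse :
    mfderiv 𝓘(ℝ, E) 𝓘(ℝ, E) η.symm (η x) = (mfderiv 𝓘(ℝ, E) 𝓘(ℝ, E) η x).inverse := by
  have h : η.MDifferentiable 𝓘(ℝ, E) 𝓘(ℝ, E) :=
    ⟨(contMDiffOn_of_mem_maximalAtlas he).mdifferentiableOn (by simp),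
      (contMDiffOn_symm_of_mem_maximalAtlas he).mdifferentiableOn (by simp)⟩
  symm
  apply ContinuousLinearMap.inverse_eq
  · have := h.comp_symm_deriv (η.map_source hx)
    rwa [η.left_inv hx] at this
  · exact h.symm_comp_deriv hx

theorem mfderiv_chartField (v : E) :
    mfderiv 𝓘(ℝ, E) 𝓘(ℝ, E) η x (chartField η v x) = v :=
  (isInvertible_mfderiv_of_mem_maximalAtlas he hx).self_apply_inverse v

theorem chartField_mfderiv (z : TangentSpace 𝓘(ℝ, E) x) :
    chartField η (mfderiv 𝓘(ℝ, E) 𝓘(ℝ, E) η x z) x = z :=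
  (isInvertible_mfderiv_of_mem_maximalAtlas he hx).inverse_apply_self z

theorem chartRep_apply (Z : Π x : M, TangentSpace 𝓘(ℝ, E) x) :
    chartRep η Z (η x) = mfderiv 𝓘(ℝ, E) 𝓘(ℝ, E) η x (Z x) := by
  have h1 : chartRep η Z (η x) =
      (mfderiv 𝓘(ℝ, E) 𝓘(ℝ, E) η.symm (η x)).inverse (Z (η.symm (η x))) := rfl
  rw [h1, mfderiv_symm_eq_inverse he hx, η.left_inv hx]
  exact congr($((isInvertible_mfderiv_of_mem_maximalAtlas he hx).inverse_inverse) (Z x))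

theorem chartField_chartRep (Z : Π x : M, TangentSpace 𝓘(ℝ, E) x) :
    chartField η (chartRep η Z (η x)) x = Z x := by
  rw [chartRep_apply he hx, chartField_mfderiv he hx]

theorem chartField_injective {u v : E} (h : chartField η u x = chartField η v x) : u = v := by
  rw [← mfderiv_chartField he hx u, h, mfderiv_chartField he hx]

variable [CompleteSpace E]

theorem contMDiffAt_chartLift {W : E → E} (hW : ContDiffAt ℝ ∞ W (η x)) :
    ContMDiffAt 𝓘(ℝ, E) 𝓘(ℝ, E).tangent ∞
      (fun y ↦ (⟨y, chartLift η W y⟩ : TangentBundle 𝓘(ℝ, E) M)) x :=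
  ContMDiffAt.mpullback_vectorField_preimage (n := ∞)
    (contMDiffAt_vectorSpace_iff_contDiffAt.2 hW)
    (contMDiffAt_of_mem_maximalAtlas he hx) (isInvertible_mfderiv_of_mem_maximalAtlas he hx)
    (by simp)

theorem mdifferentiableAt_chartLift {W : E → E} (hW : DifferentiableAt ℝ W (η x)) :
    MDifferentiableAt 𝓘(ℝ, E) 𝓘(ℝ, E).tangent
      (fun y ↦ (⟨y, chartLift η W y⟩ : TangentBundle 𝓘(ℝ, E) M)) x :=
  MDifferentiableAt.mpullback_vectorField (n := ∞)
    (mdifferentiableAt_vectorField hW)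
    (contMDiffAt_of_mem_maximalAtlas he hx) (isInvertible_mfderiv_of_mem_maximalAtlas he hx)
    two_le_infty

theorem contMDiffAt_chartField (v : E) :
    ContMDiffAt 𝓘(ℝ, E) 𝓘(ℝ, E).tangent ∞
      (fun y ↦ (⟨y, chartField η v y⟩ : TangentBundle 𝓘(ℝ, E) M)) x :=
  contMDiffAt_chartLift he hx contDiffAt_const

theorem mdifferentiableAt_chartField (v : E) :
    MDifferentiableAt 𝓘(ℝ, E) 𝓘(ℝ, E).tangent
      (fun y ↦ (⟨y, chartField η v y⟩ : TangentBundle 𝓘(ℝ, E) M)) x :=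
  mdifferentiableAt_chartLift he hx (differentiableAt_const _)

theorem contDiffAt_chartRep {Z : Π x : M, TangentSpace 𝓘(ℝ, E) x}
    (hZ : ContMDiffAt 𝓘(ℝ, E) 𝓘(ℝ, E).tangent ∞
      (fun y ↦ (⟨y, Z y⟩ : TangentBundle 𝓘(ℝ, E) M)) x) :
    ContDiffAt ℝ ∞ (chartRep η Z) (η x) := by
  refine contMDiffAt_vectorSpace_iff_contDiffAt.1 ?_
  refine ContMDiffAt.mpullback_vectorField_preimage (n := ∞) (by rwa [η.left_inv hx])
    (contMDiffAt_symm_of_mem_maximalAtlas he (η.map_source hx)) ?_ (by simp)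
  rw [mfderiv_symm_eq_inverse he hx]
  exact (isInvertible_mfderiv_of_mem_maximalAtlas he hx).inverse

/-- The bracket is natural under pullback, and constant fields on a vector space commute. -/
theorem mlieBracket_chartField (u v : E) :
    VectorField.mlieBracket 𝓘(ℝ, E) (chartField η u) (chartField η v) x = 0 := by
  have : IsManifold 𝓘(ℝ, E) (minSmoothness ℝ 2) M :=
    .of_le (n := ∞) (by rw [minSmoothness_of_isRCLikeNormedField]; exact two_le_infty)
  have := VectorField.mpullback_mlieBracket (I := 𝓘(ℝ, E)) (I' := 𝓘(ℝ, E)) (n := ∞) (f := η)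
    (V := fun _ ↦ u) (W := fun _ ↦ v) (x₀ := x)
    (mdifferentiableAt_vectorField (differentiableAt_const u))
    (mdifferentiableAt_vectorField (differentiableAt_const v))
    (contMDiffAt_of_mem_maximalAtlas he hx)
    (by rw [minSmoothness_of_isRCLikeNormedField]; exact two_le_infty)
  refine this.symm.trans ?_
  have h0 : VectorField.mlieBracket 𝓘(ℝ, E) (fun _ : E ↦ u) (fun _ : E ↦ v) (η x) = 0 := by
    have h1 := congrFun (VectorField.mlieBracketWithin_eq_lieBracketWithin (𝕜 := ℝ)
      (V := fun _ : E ↦ u) (W := fun _ : E ↦ v) (s := univ)) (η x)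
    exact (congrFun VectorField.mlieBracketWithin_univ (η x)).symm.trans
      (h1.trans (by simp [VectorField.lieBracket_eq]; rfl))
  rw [VectorField.mpullback_apply, h0, map_zero]

theorem mdifferentiableAt_comp_chart {F : Type*} [NormedAddCommGroup F] [NormedSpace ℝ F]
    {f : E → F} (hf : DifferentiableAt ℝ f (η x)) :
    MDifferentiableAt 𝓘(ℝ, E) 𝓘(ℝ, F) (fun y ↦ f (η y)) x :=
  hf.mdifferentiableAt.comp x ((contMDiffAt_of_mem_maximalAtlas he hx).mdifferentiableAt (by simp))

theorem mvfderiv_comp_chart {F : Type*} [NormedAddCommGroup F] [NormedSpace ℝ F]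
    {f : E → F} (hf : DifferentiableAt ℝ f (η x)) (u : E) :
    mvfderiv 𝓘(ℝ, E) (fun y ↦ f (η y)) x (chartField η u x) = fderiv ℝ f (η x) u := by
  have := mfderiv_comp x hf.mdifferentiableAt
    ((contMDiffAt_of_mem_maximalAtlas he hx).mdifferentiableAt (by simp))
  change mfderiv 𝓘(ℝ, E) 𝓘(ℝ, F) (f ∘ η) x (chartField η u x) = _
  rw [this, ContinuousLinearMap.comp_apply, mfderiv_chartField he hx, mfderiv_eq_fderiv]
  rfl

end

theorem trans_mem_maximalAtlas (he : η ∈ IsManifold.maximalAtlas 𝓘(ℝ, E) ∞ M)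
    {τ : OpenPartialHomeomorph E E} (hτ : ContDiffOn ℝ ∞ τ τ.source)
    (hτ' : ContDiffOn ℝ ∞ τ.symm τ.target) :
    η.trans τ ∈ IsManifold.maximalAtlas 𝓘(ℝ, E) ∞ M := by
  refine OpenPartialHomeomorph.mem_maximalAtlas_of_contMDiffOn _ ?_ ?_
  · rw [OpenPartialHomeomorph.trans_source]
    exact hτ.contMDiffOn.comp
      ((contMDiffOn_of_mem_maximalAtlas he).mono inter_subset_left) inter_subset_right
  · rw [OpenPartialHomeomorph.trans_target]
    exact (contMDiffOn_symm_of_mem_maximalAtlas he).comp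
      (hτ'.contMDiffOn.mono inter_subset_left) inter_subset_right

/-- By the chain rule a constant field of the new chart has components `(dτ)⁻¹ v` in the old one;
both the affine and the dual coordinates are studied in this way. -/
theorem chartField_trans (he : η ∈ IsManifold.maximalAtlas 𝓘(ℝ, E) ∞ M) (hx : x ∈ η.source)
    {τ : OpenPartialHomeomorph E E} (hτ : DifferentiableAt ℝ τ (η x)) (v : E) :
    chartField (η.trans τ) v x = chartField η ((fderiv ℝ τ (η x)).inverse v) x := by
  have h := mfderiv_comp x hτ.mdifferentiableAt
    ((contMDiffAt_of_mem_maximalAtlas he hx).mdifferentiableAt (by simp))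
  rw [mfderiv_eq_fderiv] at h
  rw [chartField_apply, chartField_apply, OpenPartialHomeomorph.coe_trans, h]
  exact (isInvertible_mfderiv_of_mem_maximalAtlas he hx).inverse_comp_apply_of_right

end ChartFields

/-! ### Connections in a chart -/

section Christoffel

set_option maxSynthPendingDepth 3
set_option linter.unusedSectionVars false

variable {E : Type*} [NormedAddCommGroup E] [NormedSpace ℝ E]
  {M : Type*} [TopologicalSpace M] [ChartedSpace E M] [IsManifold 𝓘(ℝ, E) ∞ M]
  {η : OpenPartialHomeomorph M E} {x : M}
  (D : CovariantDerivative 𝓘(ℝ, E) E (TangentSpace 𝓘(ℝ, E) : M → Type _))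

/-- Serves to differentiate a field expanded in the coordinate frame of a chart. -/
theorem covariantDerivative_sum_smul {ι : Type*} (t : Finset ι) {f : ι → M → ℝ}
    {s : ι → Π x : M, TangentSpace 𝓘(ℝ, E) x}
    (hf : ∀ i ∈ t, MDifferentiableAt 𝓘(ℝ, E) 𝓘(ℝ, ℝ) (f i) x)
    (hs : ∀ i ∈ t, MDifferentiableAt 𝓘(ℝ, E) 𝓘(ℝ, E).tangent
      (fun y ↦ (⟨y, s i y⟩ : TangentBundle 𝓘(ℝ, E) M)) x) :
    D (fun y ↦ ∑ i ∈ t, f i y • s i y) x =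
      ∑ i ∈ t, (f i x • D (s i) x + (mvfderiv 𝓘(ℝ, E) (f i) x).smulRight (s i x)) := by
  classical
  induction t using Finset.induction_on with
  | empty => exact congrFun D.zero x
  | insert a t ha ih =>
    have hs' := fun i hi ↦ hs i (Finset.mem_insert_of_mem hi)
    have hf' := fun i hi ↦ hf i (Finset.mem_insert_of_mem hi)
    have hsm : ∀ i ∈ insert a t, MDifferentiableAt 𝓘(ℝ, E) 𝓘(ℝ, E).tangent
        (fun y ↦ (⟨y, f i y • s i y⟩ : TangentBundle 𝓘(ℝ, E) M)) x := fun i hi ↦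
      MDifferentiableAt.smul_section (hf i hi) (hs i hi)
    simp only [Finset.sum_insert ha, ← ih hf' hs']
    rw [← D.isCovariantDerivativeOnUniv.leibniz (hs a (Finset.mem_insert_self a t))
      (hf a (Finset.mem_insert_self a t)), ← D.isCovariantDerivativeOnUniv.add]
    · rfl
    · exact hsm a (Finset.mem_insert_self a t)
    · exact MDifferentiableAt.sum_section fun i hi ↦ hsm i (Finset.mem_insert_of_mem hi)

variable [FiniteDimensional ℝ E]

/-- The Christoffel symbol of the connection `D` in the chart `η`, as a bilinear map. -/
def christoffel (η : OpenPartialHomeomorph M E) (y : E) : E →L[ℝ] E →L[ℝ] E :=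
  ∑ i, ∑ j, ((Module.finBasis ℝ E).coord i).toContinuousLinearMap.smulRight
    (((Module.finBasis ℝ E).coord j).toContinuousLinearMap.smulRight
      (chartRep η (fun x ↦ D (chartField η (Module.finBasis ℝ E j)) x
        (chartField η (Module.finBasis ℝ E i) x)) y))

variable {D} [CompleteSpace E]

theorem christoffel_apply (y u v : E) :
    christoffel D η y u v = ∑ i, ∑ j, (Module.finBasis ℝ E).repr u i •
      (Module.finBasis ℝ E).repr v j •
      chartRep η (fun x ↦ D (chartField η (Module.finBasis ℝ E j)) x
        (chartField η (Module.finBasis ℝ E i) x)) y := by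
  simp [christoffel]

/-- The covariant derivative in a chart: `∇_u W = dW(u) + C(u, W)`. -/
theorem covariantDerivative_chartLift (he : η ∈ IsManifold.maximalAtlas 𝓘(ℝ, E) ∞ M)
    (hx : x ∈ η.source) {W : E → E} (hW : DifferentiableAt ℝ W (η x)) (u : E) :
    D (chartLift η W) x (chartField η u x) =
      chartField η (fderiv ℝ W (η x) u + christoffel D η (η x) u (W (η x))) x := by
  set b := Module.finBasis ℝ E with hb
  have hcoord : ∀ j, DifferentiableAt ℝ (fun y ↦ b.coord j (W y)) (η x) := fun j ↦
    (b.coord j).toContinuousLinearMap.differentiableAt.comp (η x) hW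
  have h1 : chartLift η W = fun y ↦ ∑ j, b.coord j (W (η y)) • chartField η (b j) y := by
    funext y
    simp only [← chartField_smul, ← chartField_sum]
    rw [chartLift_eq_chartField]
    congr 1
    exact (b.sum_repr _).symm
  have h2 : ∀ j, D (chartField η (b j)) x (chartField η u x) =
      ∑ i, b.repr u i • D (chartField η (b j)) x (chartField η (b i) x) := by
    intro j
    conv_lhs => rw [← b.sum_repr u, chartField_sum, map_sum]
    simp only [chartField_smul, map_smul]
  have h3 : ∀ j, fderiv ℝ (fun y ↦ b.coord j (W y)) (η x) u = b.repr (fderiv ℝ W (η x) u) j := by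
    intro j
    exact congr($(((b.coord j).toContinuousLinearMap.hasFDerivAt.comp (η x)
      hW.hasFDerivAt).fderiv) u)
  rw [h1, covariantDerivative_sum_smul D Finset.univ
    (fun j _ ↦ mdifferentiableAt_comp_chart he hx (hcoord j))
    (fun j _ ↦ mdifferentiableAt_chartField he hx (b j)), sum_apply]
  simp only [add_apply, smul_apply, ContinuousLinearMap.smulRight_apply]
  rw [Finset.sum_add_distrib, add_comm, chartField_add]
  congr 1
  · conv_rhs => rw [← b.sum_repr (fderiv ℝ W (η x) u), chartField_sum]
    refine Finset.sum_congr rfl fun j _ ↦ ?_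
    rw [mvfderiv_comp_chart he hx (hcoord j), h3, chartField_smul]
  · rw [christoffel_apply, chartField_sum, Finset.sum_congr rfl fun i _ ↦ chartField_sum _ _,
      Finset.sum_comm]
    refine Finset.sum_congr rfl fun j _ ↦ ?_
    rw [h2, Finset.smul_sum]
    refine Finset.sum_congr rfl fun i _ ↦ ?_
    rw [chartField_smul, chartField_smul, chartField_chartRep he hx, smul_comm]
    rfl

theorem covariantDerivative_chartField (he : η ∈ IsManifold.maximalAtlas 𝓘(ℝ, E) ∞ M)
    (hx : x ∈ η.source) (u v : E) :
    D (chartField η v) x (chartField η u x) = chartField η (christoffel D η (η x) u v) x := by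
  have := covariantDerivative_chartLift (D := D) he hx (W := fun _ ↦ v)
    (differentiableAt_const _) u
  simpa using! this

/-- Needed because chart formulas for a field hold only on the chart domain. -/
theorem covariantDerivative_congr {Y Y' : Π x : M, TangentSpace 𝓘(ℝ, E) x}
    (hY : MDifferentiableAt 𝓘(ℝ, E) 𝓘(ℝ, E).tangent
      (fun y ↦ (⟨y, Y y⟩ : TangentBundle 𝓘(ℝ, E) M)) x) (h : ∀ᶠ y in 𝓝 x, Y' y = Y y) :
    D Y' x = D Y x := by
  refine D.isCovariantDerivativeOnUniv.congr_of_eventuallyEq (hY.congr_of_eventuallyEq ?_) hY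
    univ_mem h
  filter_upwards [h] with y hy
  rw [hy]

/-- A smooth connection maps locally smooth vector fields to smooth ones. -/
theorem contMDiffAt_covariantDerivative_apply [T2Space M] (hD : D.ContMDiffCovariantDerivative ∞)
    {u : Set M} (hu : IsOpen u) (hxu : x ∈ u) {X Y : Π x : M, TangentSpace 𝓘(ℝ, E) x}
    (hY : ContMDiffOn 𝓘(ℝ, E) 𝓘(ℝ, E).tangent ∞
      (fun y ↦ (⟨y, Y y⟩ : TangentBundle 𝓘(ℝ, E) M)) u)
    (hX : ContMDiffAt 𝓘(ℝ, E) 𝓘(ℝ, E).tangent ∞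
      (fun y ↦ (⟨y, X y⟩ : TangentBundle 𝓘(ℝ, E) M)) x) :
    ContMDiffAt 𝓘(ℝ, E) 𝓘(ℝ, E).tangent ∞
      (fun y ↦ (⟨y, D Y y (X y)⟩ : TangentBundle 𝓘(ℝ, E) M)) x := by
  -- Smoothness of `D` is applied to a globally smooth field, so `Y` is cut off by a bump function
  -- equal to 1 near `x`; by locality this does not change the derivative there.
  obtain ⟨f, -, hf⟩ := (SmoothBumpFunction.nhds_basis_tsupport (I := 𝓘(ℝ, E)) x).mem_iff.1
    (hu.mem_nhds hxu)
  have hσ : ContMDiff 𝓘(ℝ, E) 𝓘(ℝ, E).tangent ∞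
      (fun y ↦ (⟨y, f y • Y y⟩ : TangentBundle 𝓘(ℝ, E) M)) :=
    ContMDiffOn.smul_section_of_tsupport f.contMDiff.contMDiffOn hu hf hY
  have hDσ := (hD.contMDiff.contMDiff (σ := (f : M → ℝ) • Y) hσ.contMDiffOn).contMDiffAt
    (x := x) univ_mem
  have h1 := ContMDiffAt.clm_bundle_apply (b := fun y : M ↦ y) hDσ hX
  refine h1.congr_of_eventuallyEq ?_
  filter_upwards [f.eventuallyEq_one.eventually_nhds, hu.mem_nhds hxu] with y hy hyu
  have : D ((f : M → ℝ) • Y) y = D Y y := by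
    refine covariantDerivative_congr (((hY y hyu).contMDiffAt
      (hu.mem_nhds hyu)).mdifferentiableAt (by simp)) ?_
    filter_upwards [hy] with z hz
    simp [hz]
  rw [← this]

theorem contDiffAt_christoffel [T2Space M] (hD : D.ContMDiffCovariantDerivative ∞)
    (he : η ∈ IsManifold.maximalAtlas 𝓘(ℝ, E) ∞ M) (hx : x ∈ η.source) :
    ContDiffAt ℝ ∞ (christoffel D η) (η x) := by
  unfold christoffel
  refine ContDiffAt.sum fun i _ ↦ ContDiffAt.sum fun j _ ↦ ?_
  have h := contDiffAt_chartRep he hx (contMDiffAt_covariantDerivative_apply hD η.open_source hx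
    (fun y hy ↦ (contMDiffAt_chartField he hy (Module.finBasis ℝ E j)).contMDiffWithinAt)
    (contMDiffAt_chartField he hx (Module.finBasis ℝ E i)))
  exact contDiffAt_const.smulRight (contDiffAt_const.smulRight h)

/-- The torsion identity is evaluated on constant fields of the chart, whose bracket vanishes. -/
theorem christoffel_symm (htor : ∀ {X Y : Π x : M, TangentSpace 𝓘(ℝ, E) x},
      MDifferentiableAt 𝓘(ℝ, E) 𝓘(ℝ, E).tangent
        (fun y ↦ (⟨y, X y⟩ : TangentBundle 𝓘(ℝ, E) M)) x →
      MDifferentiableAt 𝓘(ℝ, E) 𝓘(ℝ, E).tangent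
        (fun y ↦ (⟨y, Y y⟩ : TangentBundle 𝓘(ℝ, E) M)) x →
      D Y x (X x) - D X x (Y x) = VectorField.mlieBracket 𝓘(ℝ, E) X Y x)
    (he : η ∈ IsManifold.maximalAtlas 𝓘(ℝ, E) ∞ M) (hx : x ∈ η.source) (u v : E) :
    christoffel D η (η x) u v = christoffel D η (η x) v u := by
  have h := htor (mdifferentiableAt_chartField he hx u) (mdifferentiableAt_chartField he hx v)
  rw [mlieBracket_chartField he hx, sub_eq_zero, covariantDerivative_chartField he hx,
    covariantDerivative_chartField he hx] at h
  exact chartField_injective he hx h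

theorem hasFDerivAt_apply_apply {C : E → E →L[ℝ] E →L[ℝ] E} {y : E}
    (hC : DifferentiableAt ℝ C y) (v w : E) :
    HasFDerivAt (fun z ↦ C z v w) (ContinuousLinearMap.apply ℝ E w ∘L
      ContinuousLinearMap.apply ℝ (E →L[ℝ] E) v ∘L fderiv ℝ C y) y := by
  refine ((hC.hasFDerivAt.clm_apply (hasFDerivAt_const v _)).clm_apply
    (hasFDerivAt_const w _)).congr_fderiv ?_
  ext u
  simp

/-- The inner derivative is the field with components `C(v, w)`, to which the chart formula `dW(u) +
C(u, W)` applies again. -/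
theorem covariantDerivative_covariantDerivative_chartField [T2Space M]
    (hD : D.ContMDiffCovariantDerivative ∞)
    (he : η ∈ IsManifold.maximalAtlas 𝓘(ℝ, E) ∞ M) (hx : x ∈ η.source) (u v w : E) :
    D (fun y ↦ D (chartField η w) y (chartField η v y)) x (chartField η u x) =
      chartField η (fderiv ℝ (christoffel D η) (η x) u v w +
        christoffel D η (η x) u (christoffel D η (η x) v w)) x := by
  have hW := hasFDerivAt_apply_apply ((contDiffAt_christoffel hD he hx).differentiableAt
    (by simp)) v w
  have h1 : D (fun y ↦ D (chartField η w) y (chartField η v y)) x =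
      D (chartLift η fun y ↦ christoffel D η y v w) x := by
    refine covariantDerivative_congr (mdifferentiableAt_chartLift he hx hW.differentiableAt) ?_
    filter_upwards [η.open_source.mem_nhds hx] with y hy
    rw [covariantDerivative_chartField he hy, chartLift_eq_chartField]
  have h2 := covariantDerivative_chartLift (D := D) he hx hW.differentiableAt u
  rw [hW.fderiv] at h2
  rw [h1, h2]
  rfl

end Christoffel

/-! ### Affine charts on the manifold and the metric in them -/

section DuallyFlatCharts

set_option maxSynthPendingDepth 3
set_option linter.unusedSectionVars false

variable {n : ℕ} {M : Type*} [TopologicalSpace M] [ChartedSpace (EuclideanSpace ℝ (Fin n)) M]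
  [IsManifold (𝓡 n) ∞ M] {η : OpenPartialHomeomorph M (EuclideanSpace ℝ (Fin n))} {x : M}
  {D D' : AffineConnection n M} {g : SmoothMetric n M}

theorem christoffel_flat [T2Space M] (hD : D.ContMDiffCovariantDerivative ∞)
    (hflat : IsFlatConnection D) (he : η ∈ IsManifold.maximalAtlas (𝓡 n) ∞ M) (hx : x ∈ η.source)
    (u v w : EuclideanSpace ℝ (Fin n)) :
    fderiv ℝ (christoffel D η) (η x) u v w +
        christoffel D η (η x) u (christoffel D η (η x) v w) =
      fderiv ℝ (christoffel D η) (η x) v u w +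
        christoffel D η (η x) v (christoffel D η (η x) u w) := by
  have h : curvature D (chartField η u) (chartField η v) (chartField η w) x = 0 := hflat x _ _ _
    (contMDiffAt_chartField he hx u) (contMDiffAt_chartField he hx v)
    (contMDiffAt_chartField he hx w)
  rw [curvature, mlieBracket_chartField he hx, map_zero, sub_zero, sub_eq_zero,
    covariantDerivative_covariantDerivative_chartField hD he hx,
    covariantDerivative_covariantDerivative_chartField hD he hx] at h
  exact chartField_injective he hx h

/-- A flat torsion-free connection has affine charts around every point. -/
theorem exists_affine_chart [T2Space M] (hD : D.ContMDiffCovariantDerivative ∞)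
    (htor : D.torsion = 0) (hflat : IsFlatConnection D) (p : M) :
    ∃ η ∈ IsManifold.maximalAtlas (𝓡 n) ∞ M, p ∈ η.source ∧
      ∀ x ∈ η.source, ∀ u v, D (chartField η v) x (chartField η u x) = 0 := by
  set φ := chartAt (EuclideanSpace ℝ (Fin n)) p
  have he : φ ∈ IsManifold.maximalAtlas (𝓡 n) ∞ M := IsManifold.chart_mem_maximalAtlas p
  have hp : p ∈ φ.source := mem_chart_source _ p
  have hev : ∀ {P : EuclideanSpace ℝ (Fin n) → Prop}, (∀ x ∈ φ.source, P (φ x)) →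
      ∀ᶠ y in 𝓝 (φ p), P y := fun h ↦ by
    filter_upwards [φ.open_target.mem_nhds (φ.map_source hp)] with y hy
    have := h (φ.symm y) (φ.map_target hy)
    rwa [φ.right_inv hy] at this
  obtain ⟨f, θ, hθ, hfθ⟩ := exists_affine_map (C := christoffel D φ) (x₀ := φ p)
    (hev fun x hx ↦ contDiffAt_christoffel hD he hx)
    (hev fun x hx u v ↦ christoffel_symm (D.torsion_eq_zero_iff.1 htor) he hx u v)
    (hev fun x hx u v w ↦ christoffel_flat hD hflat he hx u v w)
  have hinv : ∀ᶠ y in 𝓝 (φ p), (θ y).IsInvertible := by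
    refine hfθ.self_of_nhds.2.1.continuousAt.eventually ?_
    rw [hθ]
    exact (ContinuousLinearEquiv.refl ℝ (EuclideanSpace ℝ (Fin n))).nhds
  obtain ⟨V, hV, hVo, hpV⟩ := _root_.eventually_nhds_iff.1 (hfθ.and hinv)
  obtain ⟨τ, hpτ, hτV, hτf, hτs⟩ := exists_openPartialHomeomorph_of_contDiffOn hVo
    (fun y hy ↦ (hV y hy).1.1.contDiffWithinAt)
    (fun y hy ↦ by rw [(hV y hy).1.2.2.1.fderiv]; exact (hV y hy).2) hpV
  have hτf' : (τ : EuclideanSpace ℝ (Fin n) → EuclideanSpace ℝ (Fin n)) = f := funext hτf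
  have hτ1 : ContDiffOn ℝ ∞ τ τ.source := by
    rw [hτf']
    exact fun y hy ↦ (hV y (hτV hy)).1.1.contDiffWithinAt
  refine ⟨φ.trans τ, trans_mem_maximalAtlas he hτ1 hτs, ⟨hp, hpτ⟩, fun x hx u v ↦ ?_⟩
  have hmem : ∀ y ∈ (φ.trans τ).source, φ y ∈ V := fun y hy ↦ hτV hy.2
  have hch : ∀ y ∈ (φ.trans τ).source, ∀ w, chartField (φ.trans τ) w y =
      chartField φ ((θ (φ y)).inverse w) y := by
    intro y hy w
    have hd := (hV _ (hmem y hy)).1.2.2.1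
    rw [← hτf'] at hd
    rw [chartField_trans he hy.1 hd.differentiableAt, hd.fderiv]
  obtain ⟨⟨-, hθs, -, hdθ⟩, hθi⟩ := hV _ (hmem x hx)
  have hW : DifferentiableAt ℝ (fun y ↦ (θ y).inverse v) (φ x) := by
    obtain ⟨e, he⟩ := hθi
    have h1 : ContDiffAt ℝ 1 ContinuousLinearMap.inverse (θ (φ x)) := by
      rw [← he]; exact contDiffAt_map_inverse e
    exact ((h1.differentiableAt one_ne_zero).comp (φ x)
      (hθs.differentiableAt (by simp))).clm_apply (differentiableAt_const v)
  -- Differentiating `θ (θ⁻¹ v) = v` and inserting `dθ(u') = θ ∘ C(u', ·)` gives `θ` applied to the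
  -- left-hand side equal to zero, and `θ` is injective.
  have hcancel : ∀ u', fderiv ℝ (fun y ↦ (θ y).inverse v) (φ x) u' +
      christoffel D φ (φ x) u' ((θ (φ x)).inverse v) = 0 := by
    intro u'
    have h1 := (hθs.differentiableAt (by simp)).hasFDerivAt.clm_apply hW.hasFDerivAt
    have h2 : HasFDerivAt (fun y ↦ θ y ((θ y).inverse v))
        (0 : EuclideanSpace ℝ (Fin n) →L[ℝ] EuclideanSpace ℝ (Fin n)) (φ x) := by
      refine (hasFDerivAt_const v (φ x)).congr_of_eventuallyEq ?_
      filter_upwards [hVo.mem_nhds (hmem x hx)] with y hy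
      exact (hV y hy).2.self_apply_inverse v
    have h3 := congr($(h1.unique h2) u')
    simp only [add_apply, ContinuousLinearMap.comp_apply, ContinuousLinearMap.flip_apply, hdθ,
      ← map_add, zero_apply] at h3
    obtain ⟨e, he⟩ := hθi
    rw [← he] at h3 ⊢
    exact e.map_eq_zero_iff.1 h3
  have h1 : D (chartField (φ.trans τ) v) x = D (chartLift φ fun y ↦ (θ y).inverse v) x := by
    refine covariantDerivative_congr (mdifferentiableAt_chartLift he hx.1 hW) ?_
    filter_upwards [(φ.trans τ).open_source.mem_nhds hx] with y hy
    rw [hch y hy, chartLift_eq_chartField]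
  rw [h1, hch x hx u, covariantDerivative_chartLift he hx.1 hW, hcancel, chartField_zero]

/-- The metric in the chart `η`, as a family of bilinear forms. -/
def metricForm (g : SmoothMetric n M) (η : OpenPartialHomeomorph M (EuclideanSpace ℝ (Fin n)))
    (y : EuclideanSpace ℝ (Fin n)) :
    EuclideanSpace ℝ (Fin n) →L[ℝ] EuclideanSpace ℝ (Fin n) →L[ℝ] ℝ :=
  LinearMap.toContinuousBilinearMap <| LinearMap.mk₂ ℝ
    (fun u v ↦ g.inner (η.symm y) (chartField η u (η.symm y)) (chartField η v (η.symm y)))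
    (fun u u' v ↦ by rw [chartField_add, map_add, add_apply])
    (fun c u v ↦ by rw [chartField_smul, map_smul, smul_apply])
    (fun u v v' ↦ by rw [chartField_add, map_add])
    (fun c u v ↦ by rw [chartField_smul, map_smul])

theorem metricForm_apply' (y u v : EuclideanSpace ℝ (Fin n)) : metricForm g η y u v =
    g.inner (η.symm y) (chartField η u (η.symm y)) (chartField η v (η.symm y)) := rfl

theorem metricForm_apply (hx : x ∈ η.source) (u v : EuclideanSpace ℝ (Fin n)) :
    metricForm g η (η x) u v = g.inner x (chartField η u x) (chartField η v x) := by
  rw [metricForm_apply', η.left_inv hx]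

theorem contMDiffAt_metric_apply {X Y : Π x : M, TangentSpace (𝓡 n) x}
    (hX : SmoothFieldAt X x) (hY : SmoothFieldAt Y x) :
    ContMDiffAt (𝓡 n) 𝓘(ℝ, ℝ) ∞ (fun y ↦ g.inner y (X y) (Y y)) x := by
  have : ContMDiffAt (𝓡 n) ((𝓡 n).prod 𝓘(ℝ)) ∞
      (fun y ↦ Bundle.TotalSpace.mk' ℝ (E := Bundle.Trivial M ℝ) y (g.inner y (X y) (Y y))) x :=
    ContMDiffAt.clm_bundle_apply₂ (F₁ := EuclideanSpace ℝ (Fin n))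
      (F₂ := EuclideanSpace ℝ (Fin n)) g.contMDiff.contMDiffAt hX hY
  exact (Bundle.contMDiffAt_totalSpace.1 this).2

theorem contDiffOn_metricForm (he : η ∈ IsManifold.maximalAtlas (𝓡 n) ∞ M) :
    ContDiffOn ℝ ∞ (metricForm g η) η.target := by
  refine contDiffOn_clm_apply.2 fun u ↦ contDiffOn_clm_apply.2 fun v y hy ↦ ?_
  have hx := η.map_target hy
  have h1 := contMDiffAt_metric_apply (g := g) (contMDiffAt_chartField he hx u)
    (contMDiffAt_chartField he hx v)
  exact (h1.comp y (contMDiffAt_symm_of_mem_maximalAtlas he hy)).contDiffAt.contDiffWithinAt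

theorem mvfderiv_congr {f f' : M → ℝ} (h : f =ᶠ[𝓝 x] f') (z : TangentSpace (𝓡 n) x) :
    mvfderiv (𝓡 n) f x z = mvfderiv (𝓡 n) f' x z := by
  change mfderiv (𝓡 n) 𝓘(ℝ, ℝ) f x z = mfderiv (𝓡 n) 𝓘(ℝ, ℝ) f' x z
  rw [h.mfderiv_eq]
  rfl

section

variable (he : η ∈ IsManifold.maximalAtlas (𝓡 n) ∞ M)
include he

/-- This is the duality identity on constant fields, for which only the coefficients of the metric
are differentiated. -/
theorem fderiv_metricForm (hdual : AreDualConnections g D D')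
    (hx : x ∈ η.source) (u v w : EuclideanSpace ℝ (Fin n)) :
    fderiv ℝ (metricForm g η) (η x) u v w =
      g.inner x (D (chartField η v) x (chartField η u x)) (chartField η w x) +
        g.inner x (chartField η v x) (D' (chartField η w) x (chartField η u x)) := by
  have hG := (((contDiffOn_metricForm (g := g) he).contDiffAt
    (η.open_target.mem_nhds (η.map_source hx))).differentiableAt (by simp)).hasFDerivAt
  have hGvw := (hG.clm_apply (hasFDerivAt_const v _)).clm_apply (hasFDerivAt_const w _)
  have h1 := hdual x (chartField η u x) (chartField η v) (chartField η w)
    (mdifferentiableAt_chartField he hx v) (mdifferentiableAt_chartField he hx w)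
  have h2 : (fun y ↦ g.inner y (chartField η v y) (chartField η w y)) =ᶠ[𝓝 x]
      fun y ↦ (fun z ↦ metricForm g η z v w) (η y) := by
    filter_upwards [η.open_source.mem_nhds hx] with y hy
    exact (metricForm_apply hy v w).symm
  rw [← h1, mvfderiv_congr h2, mvfderiv_comp_chart he hx hGvw.differentiableAt, hGvw.fderiv]
  simp

theorem metricForm_symm (hx : x ∈ η.source) (u v : EuclideanSpace ℝ (Fin n)) :
    metricForm g η (η x) u v = metricForm g η (η x) v u := by
  rw [metricForm_apply hx, metricForm_apply hx, g.symm]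

theorem metricForm_pos (hx : x ∈ η.source) {u : EuclideanSpace ℝ (Fin n)} (hu : u ≠ 0) :
    0 < metricForm g η (η x) u u := by
  rw [metricForm_apply hx]
  refine g.pos x _ fun h ↦ hu ?_
  rw [← mfderiv_chartField he hx u, h, map_zero]
  rfl

/-- In an affine chart of a dually flat manifold the derivative of the metric is totally
symmetric. -/
theorem fderiv_metricForm_symm (hdual : AreDualConnections g D D') (htor : D'.torsion = 0)
    (haff : ∀ x ∈ η.source, ∀ u v, D (chartField η v) x (chartField η u x) = 0)
    (hx : x ∈ η.source) (u v w : EuclideanSpace ℝ (Fin n)) :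
    fderiv ℝ (metricForm g η) (η x) u v w = fderiv ℝ (metricForm g η) (η x) v u w := by
  -- Only the `D'` term survives in an affine chart, and absence of torsion lets `u` and `w` be
  -- exchanged. Together with the exchange of `v` and `w` in `h2`, this generates all permutations.
  have h1 : ∀ u v w, fderiv ℝ (metricForm g η) (η x) u v w =
      fderiv ℝ (metricForm g η) (η x) w v u := by
    intro u v w
    have h := christoffel_symm (D'.torsion_eq_zero_iff.1 htor) he hx u w
    rw [fderiv_metricForm he hdual hx, fderiv_metricForm he hdual hx, haff x hx, haff x hx,
      covariantDerivative_chartField he hx, covariantDerivative_chartField he hx, h]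
    simp
  have h2 : ∀ u v w, fderiv ℝ (metricForm g η) (η x) u v w =
      fderiv ℝ (metricForm g η) (η x) u w v := by
    intro u v w
    have hG := (((contDiffOn_metricForm (g := g) he).contDiffAt
      (η.open_target.mem_nhds (η.map_source hx))).differentiableAt (by simp)).hasFDerivAt
    have e1 := (hG.clm_apply (hasFDerivAt_const v _)).clm_apply (hasFDerivAt_const w _)
    have e2 := (hG.clm_apply (hasFDerivAt_const w _)).clm_apply (hasFDerivAt_const v _)
    have e3 := e1.congr_of_eventuallyEq (f₁ := fun y ↦ metricForm g η y w v) (by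
      filter_upwards [η.open_target.mem_nhds (η.map_source hx)] with y hy
      have := metricForm_symm (g := g) he (η.map_target hy) w v
      rwa [η.right_inv hy] at this)
    simpa using congr($(e3.unique e2) u)
  rw [h1 u v w, h2 w v u, h1 w u v]

end

end DuallyFlatCharts

/-! ### Monge–Ampère equations and the Legendre transformation -/

section Legendre

set_option maxSynthPendingDepth 3

variable {n : ℕ}

theorem partialDeriv_eq {Φ : EuclideanSpace ℝ (Fin n) → ℝ}
    {Φ' : EuclideanSpace ℝ (Fin n) →L[ℝ] ℝ} {y : EuclideanSpace ℝ (Fin n)}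
    (h : HasFDerivAt Φ Φ' y) (i : Fin n) :
    partialDeriv i Φ y = Φ' (EuclideanSpace.single i 1) := by
  rw [partialDeriv, h.fderiv]

theorem hessian_apply_eq {Φ : EuclideanSpace ℝ (Fin n) → ℝ}
    {l : EuclideanSpace ℝ (Fin n) → EuclideanSpace ℝ (Fin n) →L[ℝ] ℝ}
    {G : EuclideanSpace ℝ (Fin n) →L[ℝ] EuclideanSpace ℝ (Fin n) →L[ℝ] ℝ}
    {y : EuclideanSpace ℝ (Fin n)} (h : ∀ᶠ z in 𝓝 y, HasFDerivAt Φ (l z) z)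
    (hl : HasFDerivAt l G y) (i j : Fin n) :
    hessian Φ y i j = G (EuclideanSpace.single i 1) (EuclideanSpace.single j 1) := by
  have h1 : HasFDerivAt (partialDeriv j Φ)
      (ContinuousLinearMap.apply ℝ ℝ (EuclideanSpace.single j (1 : ℝ)) ∘L G) y := by
    refine ((ContinuousLinearMap.apply ℝ ℝ
      (EuclideanSpace.single j (1 : ℝ))).hasFDerivAt.comp y hl).congr_of_eventuallyEq ?_
    filter_upwards [h] with z hz
    exact partialDeriv_eq hz j
  rw [hessian, Matrix.of_apply, partialDeriv_eq h1]
  rfl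

theorem ContDiffOn.partialDeriv {Φ : EuclideanSpace ℝ (Fin n) → ℝ}
    {𝒟 : Set (EuclideanSpace ℝ (Fin n))} (ho : IsOpen 𝒟) (h : ContDiffOn ℝ ∞ Φ 𝒟) (i : Fin n) :
    ContDiffOn ℝ ∞ (partialDeriv i Φ) 𝒟 :=
  ((contDiffOn_infty_iff_fderiv_of_isOpen ho).1 h).2.clm_apply contDiffOn_const

/-- A function with positive definite Hessian solves an elliptic Monge–Ampère equation. -/
theorem solvesMongeAmpere_det_hessian {Φ : EuclideanSpace ℝ (Fin n) → ℝ}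
    {𝒟 : Set (EuclideanSpace ℝ (Fin n))} (ho : IsOpen 𝒟) (h : ContDiffOn ℝ ∞ Φ 𝒟)
    (hpos : ∀ y ∈ 𝒟, (hessian Φ y).PosDef) :
    SolvesMongeAmpere 𝒟 Φ (fun y ↦ (hessian Φ y).det) where
  isOpen_domain := ho
  smooth := h
  smooth_rhs := by
    simp only [Matrix.det_apply]
    refine ContDiffOn.sum fun σ _ ↦ ContDiffOn.const_smul _ (contDiffOn_prod fun i _ ↦ ?_)
    exact (h.partialDeriv ho i).partialDeriv ho (σ i)
  rhs_pos y hy := (hpos y hy).det_pos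
  elliptic := hpos
  det_hessian y _ := rfl

/-- The vector of components of a linear form on `ℝⁿ`. -/
def formToVector : (EuclideanSpace ℝ (Fin n) →L[ℝ] ℝ) →L[ℝ] EuclideanSpace ℝ (Fin n) :=
  (EuclideanSpace.equiv (Fin n) ℝ).symm.toContinuousLinearMap ∘L
    ContinuousLinearMap.pi fun i ↦ ContinuousLinearMap.apply ℝ ℝ (EuclideanSpace.single i 1)

theorem formToVector_apply (l : EuclideanSpace ℝ (Fin n) →L[ℝ] ℝ) (i : Fin n) :
    formToVector l i = l (EuclideanSpace.single i 1) := rfl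

theorem sum_formToVector_mul (l : EuclideanSpace ℝ (Fin n) →L[ℝ] ℝ)
    (v : EuclideanSpace ℝ (Fin n)) : l v = ∑ i, v i * formToVector l i := by
  conv_lhs => rw [← (EuclideanSpace.basisFun (Fin n) ℝ).sum_repr v, map_sum]
  simp [formToVector_apply]

theorem inner_formToVector (l : EuclideanSpace ℝ (Fin n) →L[ℝ] ℝ)
    (v : EuclideanSpace ℝ (Fin n)) : inner ℝ (formToVector l) v = l v := by
  rw [sum_formToVector_mul l v, PiLp.inner_apply]
  simp

theorem isInvertible_of_injective {A : EuclideanSpace ℝ (Fin n) →L[ℝ] EuclideanSpace ℝ (Fin n)}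
    (h : Function.Injective A) : A.IsInvertible :=
  ⟨(LinearEquiv.ofInjectiveEndo A.toLinearMap h).toContinuousLinearEquiv, by ext; rfl⟩

/-- A smooth family of positive definite symmetric bilinear forms with totally symmetric
derivative is locally the Hessian of a convex function, whose gradient is a local diffeomorphism
inverse to the gradient of the Legendre transform. -/
theorem exists_legendre_pair
    {G : EuclideanSpace ℝ (Fin n) → EuclideanSpace ℝ (Fin n) →L[ℝ]
      EuclideanSpace ℝ (Fin n) →L[ℝ] ℝ} {U : Set (EuclideanSpace ℝ (Fin n))} (hU : IsOpen U)
    {y₀ : EuclideanSpace ℝ (Fin n)} (hy₀ : y₀ ∈ U) (hG : ContDiffOn ℝ ∞ G U)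
    (hsymm : ∀ y ∈ U, ∀ u v, G y u v = G y v u) (hpos : ∀ y ∈ U, ∀ u ≠ 0, 0 < G y u u)
    (hcodazzi : ∀ y ∈ U, ∀ u v w, fderiv ℝ G y u v w = fderiv ℝ G y v u w) :
    ∃ (τ : OpenPartialHomeomorph (EuclideanSpace ℝ (Fin n)) (EuclideanSpace ℝ (Fin n)))
      (ψ ψ' : EuclideanSpace ℝ (Fin n) → ℝ), y₀ ∈ τ.source ∧ τ.source ⊆ U ∧
      ContDiffOn ℝ ∞ τ τ.source ∧ ContDiffOn ℝ ∞ τ.symm τ.target ∧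
      ContDiffOn ℝ ∞ ψ τ.source ∧ ContDiffOn ℝ ∞ ψ' τ.target ∧
      ∀ y ∈ τ.source,
        (fderiv ℝ τ y).IsInvertible ∧
        (∀ u i, fderiv ℝ τ y u i = G y u (EuclideanSpace.single i 1)) ∧
        (∀ i j, hessian ψ y i j = G y (EuclideanSpace.single i 1) (EuclideanSpace.single j 1)) ∧
        (∀ i j, hessian ψ' (τ y) i j =
          (fderiv ℝ τ y).inverse (EuclideanSpace.single i 1) j) ∧
        (∀ i, τ y i = partialDeriv i ψ y) ∧ (∀ i, y i = partialDeriv i ψ' (τ y)) ∧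
        ψ y + ψ' (τ y) = ∑ i, y i * τ y i := by
  -- Passing to a ball supplies the convexity that the potentials require.
  obtain ⟨r, hr, hrU⟩ := Metric.isOpen_iff.1 hU y₀ hy₀
  obtain ⟨l, ψ, hls, hψs, hlψ⟩ := exists_hessian_potential isOpen_ball (convex_ball y₀ r)
    (hG.mono hrU) (fun y hy ↦ hsymm y (hrU hy)) (fun y hy ↦ hcodazzi y (hrU hy))
  have hfd : ∀ y ∈ ball y₀ r, HasFDerivAt (fun y ↦ formToVector (l y)) (formToVector ∘L G y) y :=
    fun y hy ↦ formToVector.hasFDerivAt.comp y (hlψ y hy).1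
  have hinv : ∀ y ∈ ball y₀ r,
      (formToVector ∘L G y : EuclideanSpace ℝ (Fin n) →L[ℝ] _).IsInvertible := by
    -- A vector `u` in the kernel would satisfy `G y u u = 0`, against positivity.
    refine fun y hy ↦ isInvertible_of_injective ((injective_iff_map_eq_zero _).2 fun u hu ↦ ?_)
    by_contra hne
    have h1 := hpos y (hrU hy) u hne
    rw [← inner_formToVector, ← ContinuousLinearMap.comp_apply, hu, inner_zero_left] at h1
    exact lt_irrefl _ h1
  obtain ⟨τ, hτ₀, hτV, hτf, hτs⟩ := exists_openPartialHomeomorph_of_contDiffOn isOpen_ball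
    (f := fun y ↦ formToVector (l y)) (contDiffOn_const.clm_apply hls)
    (fun y hy ↦ by rw [(hfd y hy).fderiv]; exact hinv y hy) (mem_ball_self hr)
  have hτd : ∀ y ∈ τ.source, HasFDerivAt τ (formToVector ∘L G y) y := fun y hy ↦
    (hfd y (hτV hy)).congr_of_eventuallyEq (Eventually.of_forall hτf)
  have hψ : ∀ y ∈ τ.source, HasFDerivAt ψ (innerSL ℝ (τ y)) y := fun y hy ↦ by
    refine (hlψ y (hτV hy)).2.congr_fderiv ?_
    ext v
    rw [hτf, innerSL_apply_apply, inner_formToVector]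
  have hsd : ∀ y ∈ τ.source,
      HasFDerivAt τ.symm (formToVector ∘L G y : EuclideanSpace ℝ (Fin n) →L[ℝ] _).inverse (τ y) := by
    intro y hy
    obtain ⟨e, he⟩ := hinv y (hτV hy)
    rw [← he, ContinuousLinearMap.inverse_equiv]
    refine τ.hasFDerivAt_symm (τ.map_source hy) ?_
    rw [he, τ.left_inv hy]
    exact hτd y hy
  set ψ' : EuclideanSpace ℝ (Fin n) → ℝ := fun ξ ↦ inner ℝ ξ (τ.symm ξ) - ψ (τ.symm ξ) with hψ'
  -- The two terms containing the derivative of `τ.symm` cancel because the gradient of `ψ` at `y`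
  -- is `τ y`; what remains is that the gradient of `ψ'` is `τ.symm`.
  have hψ'd : ∀ y ∈ τ.source, HasFDerivAt ψ' (innerSL ℝ y) (τ y) := by
    intro y hy
    have h1 := hψ y hy
    rw [← τ.left_inv hy] at h1
    have h2 := ((hasFDerivAt_id (τ y)).inner ℝ (hsd y hy)).sub (h1.comp (τ y) (hsd y hy))
    refine h2.congr_fderiv ?_
    ext u
    simp [τ.left_inv hy, real_inner_comm]
  have hψ'd' : ∀ ξ ∈ τ.target, HasFDerivAt ψ' (innerSL ℝ (τ.symm ξ)) ξ := by
    intro ξ hξ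
    have := hψ'd _ (τ.map_target hξ)
    rwa [τ.right_inv hξ] at this
  have hτs' : ContDiffOn ℝ ∞ τ τ.source :=
    ((contDiffOn_const.clm_apply hls).mono hτV).congr fun y _ ↦ hτf y
  refine ⟨τ, ψ, ψ', hτ₀, hτV.trans hrU, hτs', hτs, hψs.mono hτV,
    contDiffOn_infty_of_hasFDerivAt τ.open_target hψ'd' (contDiffOn_const.clm_apply hτs),
    fun y hy ↦ ⟨?_, ?_, ?_, ?_, ?_, ?_, ?_⟩⟩
  · rw [(hτd y hy).fderiv]
    exact hinv y (hτV hy)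
  · intro u i
    rw [(hτd y hy).fderiv]
    rfl
  · refine hessian_apply_eq ?_ (hlψ y (hτV hy)).1
    filter_upwards [isOpen_ball.mem_nhds (hτV hy)] with z hz
    exact (hlψ z hz).2
  · intro i j
    rw [hessian_apply_eq (l := fun ξ ↦ innerSL ℝ (τ.symm ξ)) ?_
      ((innerSL ℝ).hasFDerivAt.comp (τ y) (hsd y hy)), (hτd y hy).fderiv]
    · rw [ContinuousLinearMap.comp_apply, innerSL_apply_apply,
        EuclideanSpace.inner_single_right, one_mul]
      rfl
    · filter_upwards [τ.open_target.mem_nhds (τ.map_source hy)] with ξ hξ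
      exact hψ'd' ξ hξ
  · intro i
    rw [partialDeriv_eq (hψ y hy)]
    simp [EuclideanSpace.inner_single_right]
  · intro i
    rw [partialDeriv_eq (hψ'd y hy)]
    simp [EuclideanSpace.inner_single_right]
  · simp only [hψ', τ.left_inv hy, PiLp.inner_apply]
    simp

end Legendre

/-! ### Dual affine charts and assembly of the structures -/

section DualCharts

set_option maxSynthPendingDepth 3
set_option linter.unusedSectionVars false

variable {n : ℕ} {M : Type*} [TopologicalSpace M] [ChartedSpace (EuclideanSpace ℝ (Fin n)) M]
  [IsManifold (𝓡 n) ∞ M] {η η' : OpenPartialHomeomorph M (EuclideanSpace ℝ (Fin n))} {x : M}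
  {D D' : AffineConnection n M} {g : SmoothMetric n M}

theorem coordField_eq_chartField (η : OpenPartialHomeomorph M (EuclideanSpace ℝ (Fin n)))
    (i : Fin n) : coordField η i = chartField η (EuclideanSpace.single i 1) := rfl

theorem metricMatrix_apply (hx : x ∈ η.source) (i j : Fin n) : metricMatrix g η x i j =
    metricForm g η (η x) (EuclideanSpace.single i 1) (EuclideanSpace.single j 1) := by
  rw [metricForm_apply hx]
  rfl

theorem posDef_metricMatrix (he : η ∈ IsManifold.maximalAtlas (𝓡 n) ∞ M) (hx : x ∈ η.source) :
    (metricMatrix g η x).PosDef := by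
  refine Matrix.PosDef.of_dotProduct_mulVec_pos ?_ fun v hv ↦ ?_
  · ext i j
    exact g.symm x (coordField η j x) (coordField η i x)
  · have h1 := metricForm_pos (g := g) he hx (u := WithLp.toLp 2 v)
      (fun h ↦ hv (by simpa using congr(WithLp.ofLp $h)))
    refine h1.trans_eq ?_
    rw [sum_formToVector_mul]
    simp only [dotProduct, Matrix.mulVec, formToVector_apply, metricMatrix_apply hx, star_trivial]
    refine Finset.sum_congr rfl fun i _ ↦ ?_
    rw [metricForm_symm he hx, sum_formToVector_mul]
    simp only [formToVector_apply, mul_comm]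

/-- If the constant fields of two charts pair constantly, and the first chart is affine, then the
second one is affine for the dual connection. -/
theorem covariantDerivative_eq_zero_of_dual (hdual : AreDualConnections g D D')
    (he : η ∈ IsManifold.maximalAtlas (𝓡 n) ∞ M) (he' : η' ∈ IsManifold.maximalAtlas (𝓡 n) ∞ M)
    (hs : η'.source ⊆ η.source)
    (haff : ∀ x ∈ η.source, ∀ u v, D (chartField η v) x (chartField η u x) = 0)
    {c : EuclideanSpace ℝ (Fin n) → EuclideanSpace ℝ (Fin n) → ℝ}
    (hpair : ∀ x ∈ η'.source, ∀ u v, g.inner x (chartField η u x) (chartField η' v x) = c u v)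
    (hx : x ∈ η'.source) (v : EuclideanSpace ℝ (Fin n)) (z : TangentSpace (𝓡 n) x) :
    D' (chartField η' v) x z = 0 := by
  by_contra hne
  set w := D' (chartField η' v) x z with hw
  have h1 : ∀ u, g.inner x (chartField η u x) w = 0 := by
    intro u
    have h2 := hdual x z (chartField η u) (chartField η' v)
      (mdifferentiableAt_chartField he (hs hx) u) (mdifferentiableAt_chartField he' hx v)
    have h3 : (fun y ↦ g.inner y (chartField η u y) (chartField η' v y)) =ᶠ[𝓝 x]
        fun _ ↦ c u v := by
      filter_upwards [η'.open_source.mem_nhds hx] with y hy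
      exact hpair y hy u v
    -- The pairing is constant and `D` kills the first field, so duality leaves `g(∂ᵤ, w) = 0` for
    -- every `u`.
    have h4 : D (chartField η u) x z = 0 := by
      rw [← chartField_mfderiv he (hs hx) z]
      exact haff x (hs hx) _ u
    rw [mvfderiv_congr h3, mvfderiv_const, h4, map_zero, ← hw] at h2
    simpa using h2.symm
  have h5 := g.pos x w hne
  -- With `u = dη(w)` the constant field equals `w` at `x`, so `g(w, w) = 0`.
  have h6 := h1 (mfderiv 𝓘(ℝ, EuclideanSpace ℝ (Fin n)) 𝓘(ℝ, EuclideanSpace ℝ (Fin n)) η x w)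
  rw [chartField_mfderiv he (hs hx) w] at h6
  exact h5.ne' h6

/-- Around every point of a dually flat manifold there are mutually dual affine charts which are
exchanged by a Legendre transformation. -/
theorem exists_dual_affine_charts [T2Space M] (h : IsDuallyFlat g D D') (p : M) :
    ∃ (η η' : OpenPartialHomeomorph M (EuclideanSpace ℝ (Fin n)))
      (ψ ψ' : EuclideanSpace ℝ (Fin n) → ℝ),
      p ∈ η.source ∧ η ∈ IsManifold.maximalAtlas (𝓡 n) ∞ M ∧
      η' ∈ IsManifold.maximalAtlas (𝓡 n) ∞ M ∧
      ContDiffOn ℝ ∞ ψ η.target ∧ ContDiffOn ℝ ∞ ψ' η'.target ∧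
      IsAffineCoord D η ∧ IsAffineCoord D' η' ∧ AreDualCoord g η η' ∧
      ∀ x ∈ η.source,
        hessian ψ (η x) = metricMatrix g η x ∧ hessian ψ' (η' x) = metricMatrix g η' x ∧
        hessian ψ' (η' x) = (metricMatrix g η x)⁻¹ ∧
        (∀ i, η' x i = partialDeriv i ψ (η x)) ∧ (∀ i, η x i = partialDeriv i ψ' (η' x)) ∧
        ψ (η x) + ψ' (η' x) = ∑ i, η x i * η' x i := by
  obtain ⟨φ, he, hp, haff⟩ := exists_affine_chart h.smooth h.torsion_free h.flat p
  have hev : ∀ {P : EuclideanSpace ℝ (Fin n) → Prop}, (∀ x ∈ φ.source, P (φ x)) →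
      ∀ y ∈ φ.target, P y := fun h y hy ↦ by
    have := h (φ.symm y) (φ.map_target hy)
    rwa [φ.right_inv hy] at this
  obtain ⟨τ, ψ, ψ', hpτ, -, hτs, hτs', hψ, hψ', hτ⟩ := exists_legendre_pair φ.open_target
    (φ.map_source hp) (contDiffOn_metricForm (g := g) he)
    (hev fun x hx ↦ metricForm_symm he hx) (hev fun x hx u hu ↦ metricForm_pos he hx hu)
    (hev fun x hx ↦ fderiv_metricForm_symm he h.dual h.torsion_free' haff hx)
  -- The affine chart is restricted to the domain of the gradient map `τ`, so that `η` and `η' = τ ∘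
  -- φ` have the same source.
  set η := φ.trans (OpenPartialHomeomorph.ofSet τ.source τ.open_source) with hη
  set η' := φ.trans τ with hη'
  have heη : η ∈ IsManifold.maximalAtlas (𝓡 n) ∞ M :=
    trans_mem_maximalAtlas he contDiffOn_id contDiffOn_id
  have heη' : η' ∈ IsManifold.maximalAtlas (𝓡 n) ∞ M := trans_mem_maximalAtlas he hτs hτs'
  have hinv : ∀ y ∈ τ.source, ∀ v, fderiv ℝ τ y ((fderiv ℝ τ y).inverse v) = v :=
    fun y hy v ↦ (hτ y hy).1.self_apply_inverse v
  have hch' : ∀ x ∈ η.source, ∀ v,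
      chartField η' v x = chartField φ ((fderiv ℝ τ (φ x)).inverse v) x := fun x hx v ↦
    chartField_trans he hx.1
      ((hτs.contDiffAt (τ.open_source.mem_nhds hx.2)).differentiableAt (by simp)) v
  -- The differential of `τ` is the metric with one index lowered, so `g(u, (dτ)⁻¹ v)` is the
  -- Euclidean product. Biorthogonality, the dual metric and the inverse matrix all follow from
  -- this.
  have hform : ∀ x ∈ η.source, ∀ u v,
      metricForm g φ (φ x) u ((fderiv ℝ τ (φ x)).inverse v) = ∑ i, u i * v i := by
    intro x hx u v
    rw [metricForm_symm he hx.1, sum_formToVector_mul]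
    simp only [formToVector_apply, ← (hτ (φ x) hx.2).2.1, hinv (φ x) hx.2]
  have hpair : ∀ x ∈ η.source, ∀ u v,
      g.inner x (chartField η u x) (chartField η' v x) = ∑ i, u i * v i := by
    intro x hx u v
    rw [← hform x hx, hch' x hx, metricForm_apply hx.1]
    rfl
  have haffη : ∀ x ∈ η.source, ∀ u v, D (chartField η v) x (chartField η u x) = 0 :=
    fun x hx u v ↦ haff x hx.1 u v
  refine ⟨η, η', ψ, ψ', ⟨hp, hpτ⟩, heη, heη', hψ.mono fun y hy ↦ hy.1, hψ'.mono fun y hy ↦ hy.1,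
    fun x hx i j ↦ haffη x hx _ _, fun x hx i j ↦ covariantDerivative_eq_zero_of_dual h.dual heη
      heη' subset_rfl haffη hpair hx _ _, ⟨rfl, fun x hx i j ↦ ?_⟩, fun x hx ↦ ?_⟩
  · rw [coordField_eq_chartField, coordField_eq_chartField, hpair x hx]
    simp [eq_comm]
  · obtain ⟨-, -, h1, h2, h3, h4, h5⟩ := hτ (φ x) hx.2
    have h2' : hessian ψ' (η' x) = Matrix.of fun i j ↦
      (fderiv ℝ τ (φ x)).inverse (EuclideanSpace.single i 1) j := Matrix.ext h2
    refine ⟨?_, ?_, ?_, h3, h4, h5⟩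
    · ext i j
      rw [metricMatrix_apply hx]
      exact h1 i j
    · ext i j
      -- Only `∂ⁱ` is expanded in the first chart, with components `(dτ)⁻¹ eᵢ`; pairing with `∂ʲ`
      -- then picks out the `j`-th component.
      rw [h2', metricMatrix, Matrix.of_apply, Matrix.of_apply, coordField_eq_chartField,
        coordField_eq_chartField, hch' x hx (EuclideanSpace.single i 1)]
      refine Eq.trans ?_ (hpair x hx _ _).symm
      simp
    · refine (Matrix.inv_eq_left_inv ?_).symm
      ext i j
      rw [h2', Matrix.mul_apply, Matrix.one_apply]
      have h6 := hform x hx (EuclideanSpace.single j 1) (EuclideanSpace.single i 1)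
      rw [metricForm_symm he hx.1, ← ContinuousLinearMap.flip_apply, sum_formToVector_mul] at h6
      simp only [Matrix.of_apply, metricMatrix_apply hx]
      refine h6.trans ?_
      simp [eq_comm]

end DualCharts

end

theorem theoremT (n : ℕ) (M : Type*) [TopologicalSpace M] [T2Space M]
    [ChartedSpace (EuclideanSpace ℝ (Fin n)) M] [IsManifold (𝓡 n) ∞ M]
    (g : SmoothMetric n M) (D D' : AffineConnection n M) (h : IsDuallyFlat g D D') :
    -- `S` is the structure in the `η` coordinates, `S'` the one in the dual coordinates `η*`
    ∃ S S' : MongeAmpereStructure n M, ∀ p : M,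
      IsAffineCoord D (S.coord p) ∧ IsAffineCoord D' (S'.coord p) ∧
      AreDualCoord g (S.coord p) (S'.coord p) ∧
      ∀ x ∈ (S.coord p).source,
        -- `g_{ij} = ∂ᵢ ∂ⱼ ψ` and `g^{ij} = ∂ⁱ ∂ʲ ψ*`
        hessian (S.potential p) (S.coord p x) = metricMatrix g (S.coord p) x ∧
        hessian (S'.potential p) (S'.coord p x) = metricMatrix g (S'.coord p) x ∧
        hessian (S'.potential p) (S'.coord p x) = (metricMatrix g (S.coord p) x)⁻¹ ∧
        -- Legendre transformation between the two coordinate systems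
        (∀ i, S'.coord p x i = partialDeriv i (S.potential p) (S.coord p x)) ∧
        (∀ i, S.coord p x i = partialDeriv i (S'.potential p) (S'.coord p x)) ∧
        S.potential p (S.coord p x) + S'.potential p (S'.coord p x)
          = ∑ i, S.coord p x i * S'.coord p x i := by
  choose η η' ψ ψ' hp he he' hψ hψ' haff haff' hdual hx using exists_dual_affine_charts h
  -- The right-hand sides are the Hessian determinants themselves; what must be proved is positive
  -- definiteness, which comes from the identification of the Hessians with metric matrices.
  refine ⟨⟨η, ψ, fun p y ↦ (hessian (ψ p) y).det, hp, he, fun p ↦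
    solvesMongeAmpere_det_hessian (η p).open_target (hψ p) fun y hy ↦ ?_⟩,
    ⟨η', ψ', fun p y ↦ (hessian (ψ' p) y).det, fun p ↦ (hdual p).1 ▸ hp p, he', fun p ↦
    solvesMongeAmpere_det_hessian (η' p).open_target (hψ' p) fun y hy ↦ ?_⟩,
    fun p ↦ ⟨haff p, haff' p, hdual p, hx p⟩⟩
  · have hy' := (η p).map_target hy
    rw [← (η p).right_inv hy, (hx p _ hy').1]
    exact posDef_metricMatrix (he p) hy'
  · have hy' := (η' p).map_target hy
    rw [← (η' p).right_inv hy, (hx p _ ((hdual p).1 ▸ hy')).2.1]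
    exact posDef_metricMatrix (he' p) hy'
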